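/- **Theorem.** For points $P=\{p_1,\dots,p_n\}\subset\mathbb R^d$ (pairwise distinct) with weights $w_p\in[1,\infty)$ and centers $C=(c_1,\dots,c_k)\in(\mathbb R^d)^k$ let $$\Delta^w(P,C)=\sum_{p\in P}w_p\,\min_{1\le j\le k}\|p-c_j\|^2,\qquad \Delta^w_k(P)=\inf_{C\in(\mathbb R^d)^k}\Delta^w(P,C).$$ The model of computation is the randomized real RAM: a program is a fixed finite text, working on arrays of natural numbers and arrays of real numbers; each memory access, assignment, comparison, arithmetic operation ($+,-,\times$ on naturals, $+,-,\times,\div$ on reals) and each draw of an independent uniform random number from $[0,1]$ costs one step; there is no rounding of reals. There is a single randomized real-RAM program with the following property. Given any integers $n,d,k\ge1$, any $\varepsilon\in(0,1)$, and any set $P\subset\mathbb R^d$ of $n$ points with weights $w_p\ge1$, the program always halts within $$O\!\left(nd\cdot 2^{\tilde O(k^2/\varepsilon)}\right)$$ steps, whatever the random numbers are, and outputs $k$ centers $C=(c_1',\dots,c_k')$ such that, with at least a constant positive probability, $$\Delta^w(P,C)\le(1+\varepsilon)\,\Delta^w_k(P).$$ Here the running time bound means: at most $A\,nd\,2^{A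 x(\log(2+x))^a}$ steps with $x=k^2/\varepsilon$. The constants $A$, $a$ and the lower bound on the success probability are absolute: they do not depend on $n,d,k,\varepsilon,P,w$. -/

import Mathlib

open MeasureTheory

noncomputable section

/-! ## Weighted k-means -/

/-- The weighted cost `∑ i, w i * d(p i, C)²` of the centers `C`, where `d(p, C)` is the Euclidean
distance from `p` to its nearest center. -/
def kMeansCost {n d k : ℕ} (p : Fin n → EuclideanSpace ℝ (Fin d)) (w : Fin n → ℝ)
    (C : Fin k → EuclideanSpace ℝ (Fin d)) : ℝ :=
  ∑ i, w i * Metric.infDist (p i) (Set.range C) ^ 2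

/-- The optimal weighted cost with `k` centers. -/
def optKMeansCost {n d : ℕ} (k : ℕ) (p : Fin n → EuclideanSpace ℝ (Fin d)) (w : Fin n → ℝ) : ℝ :=
  ⨅ C : Fin k → EuclideanSpace ℝ (Fin d), kMeansCost p w C

/-! ## Randomized real RAM

A program is a finite text that does not depend on the input. It works on unbounded arrays of
natural numbers and unbounded arrays of reals (both kinds are named by numerals in the program text,
so that one program uses finitely many arrays; cells are addressed by computed natural numbers).
Every arithmetic operation, memory access, comparison, assignment and random draw costs one step.
The only literals are natural numbers, and there is no conversion from reals to naturals
(no rounding). Randomness is a tape of independent uniform samples from `[0,1]`. -/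

namespace RealRAM

/-- A memory configuration, with the number of random samples that have been used so far. -/
structure State where
  nats : ℕ → ℕ → ℕ
  reals : ℕ → ℕ → ℝ
  used : ℕ

/-- Expressions with natural values; `get a i` reads cell `i` of the natural array `a`. -/
inductive NatExpr where
  | lit (c : ℕ)
  | get (a : ℕ) (i : NatExpr)
  | add (x y : NatExpr)
  | sub (x y : NatExpr)
  | mul (x y : NatExpr)

def NatExpr.eval (s : State) : NatExpr → ℕ
  | lit c => c
  | get a i => s.nats a (i.eval s)
  | add x y => x.eval s + y.eval s
  | sub x y => x.eval s - y.eval s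
  | mul x y => x.eval s * y.eval s

/-- The number of steps needed to evaluate an expression. -/
def NatExpr.cost : NatExpr → ℕ
  | lit _ => 1
  | get _ i => i.cost + 1
  | add x y => x.cost + y.cost + 1
  | sub x y => x.cost + y.cost + 1
  | mul x y => x.cost + y.cost + 1

/-- Expressions with real values; `get a i` reads cell `i` of the real array `a`.
Division by zero returns zero. -/
inductive RealExpr where
  | lit (c : ℕ)
  | get (a : ℕ) (i : NatExpr)
  | add (x y : RealExpr)
  | sub (x y : RealExpr)
  | mul (x y : RealExpr)
  | div (x y : RealExpr)

def RealExpr.eval (s : State) : RealExpr → ℝ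
  | lit c => c
  | get a i => s.reals a (i.eval s)
  | add x y => x.eval s + y.eval s
  | sub x y => x.eval s - y.eval s
  | mul x y => x.eval s * y.eval s
  | div x y => x.eval s / y.eval s

def RealExpr.cost : RealExpr → ℕ
  | lit _ => 1
  | get _ i => i.cost + 1
  | add x y => x.cost + y.cost + 1
  | sub x y => x.cost + y.cost + 1
  | mul x y => x.cost + y.cost + 1
  | div x y => x.cost + y.cost + 1

/-- Boolean tests. -/
inductive Test where
  | natLt (x y : NatExpr)
  | realLt (x y : RealExpr)
  | neg (b : Test)
  | conj (b c : Test)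

def Test.Holds (s : State) : Test → Prop
  | natLt x y => x.eval s < y.eval s
  | realLt x y => x.eval s < y.eval s
  | neg b => ¬ b.Holds s
  | conj b c => b.Holds s ∧ c.Holds s

def Test.cost : Test → ℕ
  | natLt x y => x.cost + y.cost + 1
  | realLt x y => x.cost + y.cost + 1
  | neg b => b.cost + 1
  | conj b c => b.cost + c.cost + 1

/-- Programs. `setNat a i e` and `setReal a i e` store the value of `e` in cell `i` of array `a`;
`sample a i` stores a fresh uniform sample from `[0,1]` in cell `i` of the real array `a`. -/
inductive Program where
  | skip
  | setNat (a : ℕ) (i e : NatExpr)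
  | setReal (a : ℕ) (i : NatExpr) (e : RealExpr)
  | sample (a : ℕ) (i : NatExpr)
  | seq (P Q : Program)
  | ite (b : Test) (P Q : Program)
  | loop (b : Test) (P : Program)

def State.writeNat (s : State) (a i v : ℕ) : State :=
  { s with nats := Function.update s.nats a (Function.update (s.nats a) i v) }

def State.writeReal (s : State) (a i : ℕ) (v : ℝ) : State :=
  { s with reals := Function.update s.reals a (Function.update (s.reals a) i v) }

/-- The infinite supply of random samples. -/
abbrev Tape : Type := ℕ → unitInterval

/-- The law of the tape: independent uniform samples from `[0,1]`. -/
def tapeLaw : Measure Tape := Measure.infinitePi fun _ : ℕ => (volume : Measure unitInterval)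

/-- `Exec ω P s s' t`: with the random tape `ω`, the program `P` started in the state `s` halts
after exactly `t` steps in the state `s'`. -/
inductive Exec (ω : Tape) : Program → State → State → ℕ → Prop where
  | skip (s : State) : Exec ω .skip s s 1
  | setNat (s : State) (a : ℕ) (i e : NatExpr) :
      Exec ω (.setNat a i e) s (s.writeNat a (i.eval s) (e.eval s)) (i.cost + e.cost + 1)
  | setReal (s : State) (a : ℕ) (i : NatExpr) (e : RealExpr) :
      Exec ω (.setReal a i e) s (s.writeReal a (i.eval s) (e.eval s)) (i.cost + e.cost + 1)
  | sample (s : State) (a : ℕ) (i : NatExpr) :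
      Exec ω (.sample a i) s
        { s.writeReal a (i.eval s) (ω s.used : ℝ) with used := s.used + 1 } (i.cost + 1)
  | seq {s s₁ s₂ : State} {P Q : Program} {t₁ t₂ : ℕ}
      (hP : Exec ω P s s₁ t₁) (hQ : Exec ω Q s₁ s₂ t₂) : Exec ω (.seq P Q) s s₂ (t₁ + t₂)
  | iteTrue {s s₁ : State} {b : Test} {P Q : Program} {t : ℕ}
      (hb : b.Holds s) (hP : Exec ω P s s₁ t) : Exec ω (.ite b P Q) s s₁ (b.cost + 1 + t)
  | iteFalse {s s₁ : State} {b : Test} {P Q : Program} {t : ℕ}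
      (hb : ¬ b.Holds s) (hQ : Exec ω Q s s₁ t) : Exec ω (.ite b P Q) s s₁ (b.cost + 1 + t)
  | loopStop {s : State} {b : Test} {P : Program}
      (hb : ¬ b.Holds s) : Exec ω (.loop b P) s s (b.cost + 1)
  | loopStep {s s₁ s₂ : State} {b : Test} {P : Program} {t₁ t₂ : ℕ}
      (hb : b.Holds s) (hP : Exec ω P s s₁ t₁) (hL : Exec ω (.loop b P) s₁ s₂ t₂) :
      Exec ω (.loop b P) s s₂ (b.cost + 1 + t₁ + t₂)

/-- For a fixed tape, the final state and the number of steps are determined by the input. -/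
theorem Exec.deterministic {ω : Tape} {P : Program} {s s₁ s₂ : State} {t₁ t₂ : ℕ}
    (h₁ : Exec ω P s s₁ t₁) (h₂ : Exec ω P s s₂ t₂) : s₁ = s₂ ∧ t₁ = t₂ := by
  induction h₁ generalizing s₂ t₂ with
  | skip | setNat | setReal | sample => cases h₂; exact ⟨rfl, rfl⟩
  | seq _ _ ihP ihQ =>
    cases h₂ with
    | seq hP hQ =>
      obtain ⟨rfl, rfl⟩ := ihP hP
      obtain ⟨rfl, rfl⟩ := ihQ hQ
      exact ⟨rfl, rfl⟩
  | iteTrue hb _ ih =>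
    cases h₂ with
    | iteTrue _ h => obtain ⟨rfl, rfl⟩ := ih h; exact ⟨rfl, rfl⟩
    | iteFalse hb' _ => exact absurd hb hb'
  | iteFalse hb _ ih =>
    cases h₂ with
    | iteTrue hb' _ => exact absurd hb' hb
    | iteFalse _ h => obtain ⟨rfl, rfl⟩ := ih h; exact ⟨rfl, rfl⟩
  | loopStop hb =>
    cases h₂ with
    | loopStop _ => exact ⟨rfl, rfl⟩
    | loopStep hb' _ _ => exact absurd hb' hb
  | loopStep hb _ _ ihP ihL =>
    cases h₂ with
    | loopStop hb' => exact absurd hb hb'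
    | loopStep _ hP hL =>
      obtain ⟨rfl, rfl⟩ := ihP hP
      obtain ⟨rfl, rfl⟩ := ihL hL
      exact ⟨rfl, rfl⟩

/-- The initial state for a weighted k-means instance. Cell `0` of the natural arrays `0`, `1`, `2`
holds `n`, `d`, `k`. The real array `0` holds the points one after the other (coordinate `j` of
point `i` in cell `i * d + j`), the real array `1` the weights, and cell `0` of the real array `2`
the accuracy `ε`. Everything else is zero. -/
def inputState {n d : ℕ} (k : ℕ) (ε : ℝ) (p : Fin n → EuclideanSpace ℝ (Fin d))
    (w : Fin n → ℝ) : State where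
  nats a i :=
    if i = 0 then (if a = 0 then n else if a = 1 then d else if a = 2 then k else 0) else 0
  reals a i :=
    if a = 0 then
      (if h : i < n * d then
        p ⟨i / d, Nat.div_lt_of_lt_mul (by rwa [Nat.mul_comm] at h)⟩
          ⟨i % d, Nat.mod_lt i (Nat.pos_of_ne_zero (by rintro rfl; simp at h))⟩
      else 0)
    else if a = 1 then (if h : i < n then w ⟨i, h⟩ else 0)
    else if a = 2 then (if i = 0 then ε else 0)
    else 0
  used := 0

/-- The `k` centers in `ℝ^d` stored in a final state: coordinate `j` of center `c` is cell
`c * d + j` of the real array `3`. -/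
def outputCenters (d k : ℕ) (s : State) : Fin k → EuclideanSpace ℝ (Fin d) :=
  fun c => WithLp.toLp 2 fun j => s.reals 3 (c * d + j)

end RealRAM

end

/-! The program repeats a simple sampling step. It keeps `k` current centers and replaces them
cyclically, one at a time, by the mean of `M = ⌈100 / ε⌉` random items. An item is either a point,
drawn in proportion to its share of the current cost `T`, or a current center, and each center
carries the full mass `T`. The cheapest configuration met so far is recorded.

Fix an assignment of the points that minimises the sum `Φ` of the centroid costs, so that `Φ` is at
most the optimum. A nonempty cluster counts as covered when a center placed earlier in the same
trial is so near its centroid that it serves the cluster within the factor `1 + ε / 2`. While `T >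
(1 + ε) Φ`, some uncovered cluster `O` pays at least `ε / (4 k) * T` (`exists_expensive_cluster`).
Sampling `O` with its own weights is hindered only by its points that lie close to current centers,
since these have little mass. Each such point is replaced by its nearest center, an item of large
mass. The total weighted squared displacement is `O(1 / (ε M²))` times the cost of `O`
(`sum_moved_le`), so the centroid barely moves. The law of one draw now dominates `α = 1 / (M² k (k
+ 1))` times the law of the perturbed cluster. By Chebyshev, `M` draws from the perturbed cluster
have a good mean with probability at least one half, so the step covers `O` with probability at
least `α ^ M / 2` (`half_le_tapeLaw_sumSet`, `exists_cluster_of_resample`).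

After `k` such successes every cluster is covered. Hence a trial of `k` steps succeeds with
probability at least `q = (α ^ M / 2) ^ k` from every starting configuration (`le_succSet_trial`);
nothing is reset between trials. Since `trials k M = (2 / α) ^ (M k) ≥ 1 / q`, all trials fail with
probability at most `exp (-1)`.

No conditional probabilities appear. Samples are peeled off the tape one at a time (`map_consTape`),
and every estimate has the form `b + gain`, where `b` is a lower bound for the later success
probability that is valid from all configurations.

The link to the machine is `mainProg_runs`: the program computes `Conf.iterate`, a plain function of
the tape, within a number of steps that does not depend on the tape. That number is a polynomial
times the number of trials, whose logarithm is `O(x log (2 + x))` with `x = k² / ε` (`time_bound`).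
-/

/-! ## A calculus for bounding the running time of programs -/

namespace RealRAM

/-- The natural arrays that a program may modify. -/
def Program.natWrites : Program → List ℕ
  | .skip => []
  | .setNat a _ _ => [a]
  | .setReal _ _ _ => []
  | .sample _ _ => []
  | .seq P Q => P.natWrites ++ Q.natWrites
  | .ite _ P Q => P.natWrites ++ Q.natWrites
  | .loop _ P => P.natWrites

/-- The real arrays that a program may modify. -/
def Program.realWrites : Program → List ℕ
  | .skip => []
  | .setNat _ _ _ => []
  | .setReal a _ _ => [a]
  | .sample a _ => [a]
  | .seq P Q => P.realWrites ++ Q.realWrites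
  | .ite _ P Q => P.realWrites ++ Q.realWrites
  | .loop _ P => P.realWrites

/-- Whether a program contains no sampling instruction. -/
def Program.sampleFree : Program → Bool
  | .skip => true
  | .setNat _ _ _ => true
  | .setReal _ _ _ => true
  | .sample _ _ => false
  | .seq P Q => P.sampleFree && Q.sampleFree
  | .ite _ P Q => P.sampleFree && Q.sampleFree
  | .loop _ P => P.sampleFree

/-- The states `s` and `s'` differ at most in what `P` may modify. -/
structure Same (P : Program) (s s' : State) : Prop where
  nats : ∀ a, a ∉ P.natWrites → s'.nats a = s.nats a
  reals : ∀ a, a ∉ P.realWrites → s'.reals a = s.reals a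
  used : P.sampleFree = true → s'.used = s.used

theorem Same.refl (P : Program) (s : State) : Same P s s :=
  ⟨fun _ _ => rfl, fun _ _ => rfl, fun _ => rfl⟩

theorem Same.trans {P : Program} {s₁ s₂ s₃ : State} (h : Same P s₁ s₂) (h' : Same P s₂ s₃) :
    Same P s₁ s₃ :=
  ⟨fun a ha => (h'.nats a ha).trans (h.nats a ha),
   fun a ha => (h'.reals a ha).trans (h.reals a ha),
   fun hs => (h'.used hs).trans (h.used hs)⟩

theorem Same.mono {P Q : Program} {s s' : State} (h : Same P s s')
    (hn : P.natWrites ⊆ Q.natWrites) (hr : P.realWrites ⊆ Q.realWrites)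
    (hs : Q.sampleFree = true → P.sampleFree = true) : Same Q s s' :=
  ⟨fun a ha => h.nats a fun h' => ha (hn h'), fun a ha => h.reals a fun h' => ha (hr h'),
   fun h' => h.used (hs h')⟩

theorem State.writeNat_nats_self (s : State) (a i v : ℕ) : (s.writeNat a i v).nats a i = v := by
  simp [State.writeNat]

theorem State.writeNat_nats_ne (s : State) {a b : ℕ} (i v : ℕ) (h : b ≠ a) :
    (s.writeNat a i v).nats b = s.nats b := by
  simp [State.writeNat, h]

theorem State.writeReal_reals_ne (s : State) {a b : ℕ} (i : ℕ) (v : ℝ) (h : b ≠ a) :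
    (s.writeReal a i v).reals b = s.reals b := by
  simp [State.writeReal, h]

theorem State.writeReal_reals (s : State) (a i : ℕ) (v : ℝ) (j : ℕ) :
    (s.writeReal a i v).reals a j = if j = i then v else s.reals a j := by
  simp [State.writeReal, Function.update_apply]

@[simp] theorem State.writeNat_reals (s : State) (a i v : ℕ) :
    (s.writeNat a i v).reals = s.reals := rfl

@[simp] theorem State.writeReal_nats (s : State) (a i : ℕ) (v : ℝ) :
    (s.writeReal a i v).nats = s.nats := rfl

@[simp] theorem State.writeNat_used (s : State) (a i v : ℕ) :
    (s.writeNat a i v).used = s.used := rfl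

@[simp] theorem State.writeReal_used (s : State) (a i : ℕ) (v : ℝ) :
    (s.writeReal a i v).used = s.used := rfl

theorem Same.writeReal {P : Program} (s : State) {a : ℕ} (i : ℕ) (v : ℝ) (h : a ∈ P.realWrites) :
    Same P s (s.writeReal a i v) :=
  ⟨fun _ _ => rfl, fun _ hb => State.writeReal_reals_ne _ _ _ fun e => hb (e ▸ h), fun _ => rfl⟩

/-- This is the frame rule. The write lists of concrete programs are explicit lists of numerals, so
the side conditions for carrying a fact across a subprogram are settled by `decide`. -/
theorem Exec.same {ω : Tape} {P : Program} {s s' : State} {t : ℕ} (h : Exec ω P s s' t) :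
    Same P s s' := by
  induction h with
  | skip => exact Same.refl _ _
  | setNat s a i e =>
    exact ⟨fun b hb => State.writeNat_nats_ne _ _ _ (by simpa [Program.natWrites] using hb),
      fun _ _ => rfl, fun _ => rfl⟩
  | setReal s a i e =>
    exact ⟨fun _ _ => rfl,
      fun b hb => State.writeReal_reals_ne _ _ _ (by simpa [Program.realWrites] using hb),
      fun _ => rfl⟩
  | sample s a i =>
    exact ⟨fun _ _ => rfl,
      fun b hb => State.writeReal_reals_ne _ _ _ (by simpa [Program.realWrites] using hb),
      fun h => by simp [Program.sampleFree] at h⟩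
  | seq _ _ ih₁ ih₂ =>
    exact (ih₁.mono (by simp [Program.natWrites]) (by simp [Program.realWrites])
        (by simp +contextual [Program.sampleFree])).trans
      (ih₂.mono (by simp [Program.natWrites]) (by simp [Program.realWrites])
        (by simp +contextual [Program.sampleFree]))
  | iteTrue _ _ ih =>
    exact ih.mono (by simp [Program.natWrites]) (by simp [Program.realWrites])
        (by simp +contextual [Program.sampleFree])
  | iteFalse _ _ ih =>
    exact ih.mono (by simp [Program.natWrites]) (by simp [Program.realWrites])
        (by simp +contextual [Program.sampleFree])
  | loopStop => exact Same.refl _ _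
  | loopStep _ _ _ ih₁ ih₂ =>
    exact Same.trans (ih₁.mono (by simp [Program.natWrites]) (by simp [Program.realWrites])
        (by simp +contextual [Program.sampleFree])) ih₂

/-- Started in `s`, the program `P` halts within `T` steps in a state satisfying `Q`. -/
def Runs (ω : Tape) (P : Program) (s : State) (T : ℕ) (Q : State → Prop) : Prop :=
  ∃ s' t, Exec ω P s s' t ∧ t ≤ T ∧ Q s'

variable {ω : Tape} {P P' : Program} {s : State} {T T' : ℕ} {Q Q' : State → Prop}

theorem Runs.mono (h : Runs ω P s T Q) (hT : T ≤ T') (hQ : ∀ s', Q s' → Q' s') :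
    Runs ω P s T' Q' := by
  obtain ⟨s', t, he, ht, hq⟩ := h
  exact ⟨s', t, he, ht.trans hT, hQ _ hq⟩

theorem Runs.same (h : Runs ω P s T Q) : Runs ω P s T fun s' => Q s' ∧ Same P s s' := by
  obtain ⟨s', t, he, ht, hq⟩ := h
  exact ⟨s', t, he, ht, hq, he.same⟩

theorem Runs.skip (hT : 1 ≤ T) (hQ : Q s) : Runs ω .skip s T Q := ⟨s, 1, .skip s, hT, hQ⟩

theorem Runs.setNat {a : ℕ} {i e : NatExpr} (hT : i.cost + e.cost + 1 ≤ T)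
    (hQ : Q (s.writeNat a (i.eval s) (e.eval s))) : Runs ω (.setNat a i e) s T Q :=
  ⟨_, _, .setNat s a i e, hT, hQ⟩

theorem Runs.setReal {a : ℕ} {i : NatExpr} {e : RealExpr} (hT : i.cost + e.cost + 1 ≤ T)
    (hQ : Q (s.writeReal a (i.eval s) (e.eval s))) : Runs ω (.setReal a i e) s T Q :=
  ⟨_, _, .setReal s a i e, hT, hQ⟩

theorem Runs.sample {a : ℕ} {i : NatExpr} (hT : i.cost + 1 ≤ T)
    (hQ : Q { s.writeReal a (i.eval s) (ω s.used : ℝ) with used := s.used + 1 }) :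
    Runs ω (.sample a i) s T Q :=
  ⟨_, _, .sample s a i, hT, hQ⟩

theorem Runs.seq (h : Runs ω P s T fun s₁ => Runs ω P' s₁ T' Q) :
    Runs ω (.seq P P') s (T + T') Q := by
  obtain ⟨s₁, t₁, he₁, ht₁, s₂, t₂, he₂, ht₂, hq⟩ := h
  exact ⟨s₂, _, he₁.seq he₂, Nat.add_le_add ht₁ ht₂, hq⟩

theorem Runs.bind (h : Runs ω P s T Q') (h' : ∀ s₁, Same P s s₁ → Q' s₁ → Runs ω P' s₁ T' Q) :
    Runs ω (.seq P P') s (T + T') Q :=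
  Runs.seq (h.same.mono le_rfl fun s₁ hs => h' s₁ hs.2 hs.1)

theorem Runs.ite {b : Test} (h₁ : b.Holds s → Runs ω P s T Q) (h₂ : ¬ b.Holds s → Runs ω P' s T Q) :
    Runs ω (.ite b P P') s (b.cost + 1 + T) Q := by
  by_cases hb : b.Holds s
  · obtain ⟨s', t, he, ht, hq⟩ := h₁ hb
    exact ⟨s', _, .iteTrue hb he, by omega, hq⟩
  · obtain ⟨s', t, he, ht, hq⟩ := h₂ hb
    exact ⟨s', _, .iteFalse hb he, by omega, hq⟩

/-- The step hypothesis may use `Same P s s'` relative to the state before the loop, so an invariant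
only has to mention what the body changes. -/
theorem Runs.loop {b : Test} (N : ℕ) (Inv : ℕ → State → Prop) (h₀ : Inv 0 s)
    (hstep : ∀ i < N, ∀ s', Same P s s' → Inv i s' → b.Holds s' ∧ Runs ω P s' T (Inv (i + 1)))
    (hend : ∀ s', Inv N s' → ¬ b.Holds s') :
    Runs ω (.loop b P) s (N * (b.cost + 1 + T) + (b.cost + 1)) (Inv N) := by
  suffices H : ∀ m i, i + m = N → ∀ s', Same P s s' → Inv i s' →
      Runs ω (.loop b P) s' (m * (b.cost + 1 + T) + (b.cost + 1)) (Inv N) from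
    H N 0 (by omega) s (Same.refl _ _) h₀
  intro m
  induction m with
  | zero =>
    rintro i rfl s' - hi
    exact ⟨s', _, .loopStop (hend s' hi), by omega, hi⟩
  | succ m ih =>
    intro i hi s' hsame hinv
    obtain ⟨hb, s₁, t₁, he₁, ht₁, hq₁⟩ := hstep i (by omega) s' hsame hinv
    obtain ⟨s₂, t₂, he₂, ht₂, hq₂⟩ := ih (i + 1) (by omega) s₁ (hsame.trans he₁.same) hq₁
    exact ⟨s₂, _, .loopStep hb he₁ he₂, by rw [Nat.add_mul]; omega, hq₂⟩

/-- `for v < bound do P`, with the counter in cell `0` of the natural array `v`. -/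
def Program.forLoop (v : ℕ) (bound : NatExpr) (P : Program) : Program :=
  .seq (.setNat v (.lit 0) (.lit 0))
    (.loop (.natLt (.get v (.lit 0)) bound)
      (.seq P (.setNat v (.lit 0) (.add (.get v (.lit 0)) (.lit 1)))))

theorem Runs.forLoop {v : ℕ} {bound : NatExpr} (N : ℕ) (Inv : ℕ → State → Prop)
    (h₀ : Inv 0 (s.writeNat v 0 0))
    (hbound : ∀ s', Same (.forLoop v bound P) s s' → bound.eval s' = N)
    (hv : v ∉ P.natWrites)
    (hstep : ∀ i < N, ∀ s', Same (.forLoop v bound P) s s' → s'.nats v 0 = i → Inv i s' →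
      -- The invariant is required after the counter has been advanced, because `Inv` is an
      -- arbitrary predicate and may read the counter cell.
      Runs ω P s' T fun s'' => Inv (i + 1) (s''.writeNat v 0 (i + 1))) :
    Runs ω (.forLoop v bound P) s ((N + 1) * (bound.cost + T + 15)) (Inv N) := by
  have hsub : ∀ s', Same (.seq P (.setNat v (.lit 0) (.add (.get v (.lit 0)) (.lit 1))))
      (s.writeNat v 0 0) s' → Same (.forLoop v bound P) s s' := by
    intro s' h
    refine Same.trans (s₂ := s.writeNat v 0 0) ⟨fun a ha => ?_, fun _ _ => rfl, fun _ => rfl⟩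
      (h.mono (by simp [Program.forLoop, Program.natWrites])
        (by simp [Program.forLoop, Program.realWrites])
        (by simp [Program.forLoop, Program.sampleFree]))
    exact State.writeNat_nats_ne _ _ _ (by rintro rfl; simp [Program.forLoop, Program.natWrites] at ha)
  have key := Runs.loop (ω := ω) (s := s.writeNat v 0 0) (T := T + 6)
    (P := .seq P (.setNat v (.lit 0) (.add (.get v (.lit 0)) (.lit 1))))
    (b := .natLt (.get v (.lit 0)) bound) N
    (fun i s' => Inv i s' ∧ s'.nats v 0 = i ∧ Same (.forLoop v bound P) s s')
    ⟨h₀, State.writeNat_nats_self _ _ _ _, hsub _ (Same.refl _ _)⟩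
    (by
      rintro i hi s' hs ⟨hinv, hiv, hsame⟩
      refine ⟨by simpa [Test.Holds, NatExpr.eval, hiv, hbound s' hsame] using hi, ?_⟩
      refine (Runs.seq (T' := 6) ((hstep i hi s' hsame hiv hinv).same.mono le_rfl
        (Q' := fun s₁ => Runs ω (.setNat v (.lit 0) (.add (.get v (.lit 0)) (.lit 1))) s₁ 6
          fun s₂ => Inv (i + 1) s₂ ∧ s₂.nats v 0 = i + 1) ?_)).same.mono le_rfl ?_
      · rintro s₁ ⟨h₁, h₂⟩
        refine Runs.setNat (by simp [NatExpr.cost]) ?_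
        have e : s₁.nats v 0 = i := by rw [h₂.nats v hv, hiv]
        simp only [NatExpr.eval, e]
        exact ⟨h₁, State.writeNat_nats_self _ _ _ _⟩
      · rintro s₂ ⟨⟨h₁, h₂⟩, h₃⟩
        exact ⟨h₁, h₂, hsub _ (hs.trans h₃)⟩)
    (by
      rintro s' ⟨-, hiv, hsame⟩
      simp [Test.Holds, NatExpr.eval, hiv, hbound s' hsame])
  refine Runs.mono (Runs.seq (T := 3) (Runs.setNat (by simp [NatExpr.cost]) key)) ?_
    (fun _ h => h.1)
  simp only [Test.cost, NatExpr.cost]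
  nlinarith [Nat.zero_le N, Nat.zero_le bound.cost, Nat.zero_le T]

end RealRAM

/-! ## The sampling algorithm and its effect on the memory -/

namespace RealRAM

noncomputable section

variable {n d k : ℕ}

/-- The points followed by the centers. -/
def items (p : Fin n → EuclideanSpace ℝ (Fin d)) (C : Fin k → EuclideanSpace ℝ (Fin d)) (i : ℕ) :
    EuclideanSpace ℝ (Fin d) :=
  if h : i < n then p ⟨i, h⟩ else if h : i - n < k then C ⟨i - n, h⟩ else 0

/-- The sampling weights: a point gets its share of the cost, a center gets the whole cost. -/
def mass (p : Fin n → EuclideanSpace ℝ (Fin d)) (w : Fin n → ℝ)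
    (C : Fin k → EuclideanSpace ℝ (Fin d)) (i : ℕ) : ℝ :=
  if h : i < n then w ⟨i, h⟩ * Metric.infDist (p ⟨i, h⟩) (Set.range C) ^ 2 else kMeansCost p w C

/-- The last index below `N` at which the partial sums of `m` do not exceed `v`. -/
def pick (m : ℕ → ℝ) (v : ℝ) : ℕ → ℕ
  | 0 => 0
  | N + 1 => if v < ∑ i ∈ Finset.range N, m i then pick m v N else N

/-- The index of the item selected by the uniform sample `r`. -/
def drawIndex (p : Fin n → EuclideanSpace ℝ (Fin d)) (w : Fin n → ℝ)
    (C : Fin k → EuclideanSpace ℝ (Fin d)) (r : ℝ) : ℕ :=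
  pick (mass p w C) (r * ((k + 1) * kMeansCost p w C)) (n + k)

/-- The memory holds the parameters `n`, `d`, `k`, `M` and the weights. -/
structure Env (d k M : ℕ) (w : Fin n → ℝ) (s : State) : Prop where
  n_eq : s.nats 0 0 = n
  d_eq : s.nats 1 0 = d
  k_eq : s.nats 2 0 = k
  M_eq : s.nats 3 0 = M
  w_eq : ∀ i : Fin n, s.reals 1 i = w i
  M_real : s.reals 5 0 = M

theorem Env.of_same {M : ℕ} {w : Fin n → ℝ} {P : Program} {s s' : State} (h : Env d k M w s)
    (hs : Same P s s') (hn : ∀ a ∈ [0, 1, 2, 3], a ∉ P.natWrites)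
    (hr : ∀ a ∈ [1, 5], a ∉ P.realWrites) : Env d k M w s' := by
  simp only [List.mem_cons, List.not_mem_nil, or_false, forall_eq_or_imp, forall_eq] at hn hr
  obtain ⟨h0, h1, h2, h3⟩ := hn
  exact ⟨by rw [hs.nats _ h0, h.n_eq], by rw [hs.nats _ h1, h.d_eq], by rw [hs.nats _ h2, h.k_eq],
    by rw [hs.nats _ h3, h.M_eq], by rw [hs.reals _ hr.1]; exact h.w_eq,
    by rw [hs.reals _ hr.2, h.M_real]⟩

/-- The real array `0` holds the items. -/
def Holds (p : Fin n → EuclideanSpace ℝ (Fin d)) (C : Fin k → EuclideanSpace ℝ (Fin d))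
    (s : State) : Prop :=
  ∀ i < n + k, ∀ j : Fin d, s.reals 0 (i * d + j) = items p C i j

theorem Holds.of_same {p : Fin n → EuclideanSpace ℝ (Fin d)} {C : Fin k → EuclideanSpace ℝ (Fin d)}
    {P : Program} {s s' : State} (h : Holds p C s) (hs : Same P s s') (hr : 0 ∉ P.realWrites) :
    Holds p C s' := by
  intro i hi j
  rw [hs.reals _ hr, h i hi j]

/-- The scalar in cell `0` of the natural array `a`. -/
abbrev nvar (a : ℕ) : NatExpr := .get a (.lit 0)

/-- The scalar in cell `0` of the real array `a`. -/
abbrev rvar (a : ℕ) : RealExpr := .get a (.lit 0)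

/-! ### Distances, cost and sampling weights on the machine -/

open Program in
/-- The squared distance from the current item to the current center. -/
def distProg : Program :=
  seq (setReal 10 (.lit 0) (.lit 0))
    (forLoop 6 (nvar 1) (setReal 10 (.lit 0) (.add (rvar 10) (.mul
      (.sub (.get 0 (.add (.mul (nvar 4) (nvar 1)) (nvar 6)))
        (.get 0 (.add (.mul (.add (nvar 0) (nvar 5)) (nvar 1)) (nvar 6))))
      (.sub (.get 0 (.add (.mul (nvar 4) (nvar 1)) (nvar 6)))
        (.get 0 (.add (.mul (.add (nvar 0) (nvar 5)) (nvar 1)) (nvar 6))))))))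

variable {ω : Tape} {s : State} {M : ℕ} {w : Fin n → ℝ} {p : Fin n → EuclideanSpace ℝ (Fin d)}
  {C : Fin k → EuclideanSpace ℝ (Fin d)}

theorem distProg_runs (he : Env d k M w s) (hC : Holds p C s) {i l : ℕ} (hi : i < n) (hl : l < k)
    (h4 : s.nats 4 0 = i) (h5 : s.nats 5 0 = l) :
    Runs ω distProg s (100 * (d + 1)) fun s' =>
      s'.reals 10 0 = dist (p ⟨i, hi⟩) (C ⟨l, hl⟩) ^ 2 := by
  have key : ∀ s₁, Same distProg s s₁ → s₁.reals 10 0 = 0 → Runs ω _ s₁ _ _ := fun s₁ hs h10 =>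
    Runs.forLoop (v := 6) (bound := nvar 1) (ω := ω) (s := s₁) (T := 60)
      (P := .setReal 10 (.lit 0) (.add (rvar 10) (.mul
      (.sub (.get 0 (.add (.mul (nvar 4) (nvar 1)) (nvar 6)))
        (.get 0 (.add (.mul (.add (nvar 0) (nvar 5)) (nvar 1)) (nvar 6))))
      (.sub (.get 0 (.add (.mul (nvar 4) (nvar 1)) (nvar 6)))
        (.get 0 (.add (.mul (.add (nvar 0) (nvar 5)) (nvar 1)) (nvar 6))))))) d
      (fun j s' => s'.reals 10 0 = ∑ j' ∈ Finset.range j,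
        (s.reals 0 (i * d + j') - s.reals 0 ((n + l) * d + j')) ^ 2)
      (by simpa using h10)
      (by
        intro s' hs'
        simp [NatExpr.eval, hs'.nats 1 (by decide), hs.nats 1 (by decide), he.d_eq])
      (by decide)
      (by
        intro j hj s' hs' h6 hinv
        refine Runs.setReal (by simp [NatExpr.cost, RealExpr.cost]) ?_
        rw [Finset.sum_range_succ, ← hinv]
        simp [State.writeReal_reals, NatExpr.eval, RealExpr.eval, h6,
          hs'.nats 1 (by decide), hs.nats 1 (by decide), he.d_eq,
          hs'.nats 0 (by decide), hs.nats 0 (by decide), he.n_eq,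
          hs'.nats 4 (by decide), hs.nats 4 (by decide), h4,
          hs'.nats 5 (by decide), hs.nats 5 (by decide), h5,
          hs'.reals 0 (by decide), hs.reals 0 (by decide), sq])
  refine Runs.mono (Runs.seq (T := 3) (Runs.setReal (by simp [NatExpr.cost, RealExpr.cost])
    (key _ ⟨fun _ _ => rfl, fun a ha => State.writeReal_reals_ne _ _ _ ?_, fun _ => rfl⟩ ?_)))
    ?_ ?_
  · rintro rfl; exact ha (by decide)
  · simp [State.writeReal_reals, NatExpr.eval, RealExpr.eval]
  · simp [NatExpr.cost]; omega
  · intro s' hs'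
    rw [hs', EuclideanSpace.dist_eq, Real.sq_sqrt (Finset.sum_nonneg fun _ _ => sq_nonneg _),
      Finset.sum_range]
    refine Finset.sum_congr rfl fun j _ => ?_
    rw [hC i (by omega), hC (n + l) (by omega), Real.dist_eq, sq_abs]
    simp [items, hi, hl]

theorem infDist_sq_eq_of_forall_le {E : Type*} {ι : Type*} [PseudoMetricSpace E] {x : E} {c : ι → E} {r : ℝ}
    (hle : ∀ l, r ≤ dist x (c l) ^ 2) (heq : ∃ l, r = dist x (c l) ^ 2) :
    r = Metric.infDist x (Set.range c) ^ 2 := by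
  obtain ⟨l, rfl⟩ := heq
  congr 1
  refine le_antisymm ((Metric.le_infDist (Set.range_nonempty_iff_nonempty.2 ⟨l⟩)).2 ?_) (Metric.infDist_le_dist_of_mem ⟨l, rfl⟩)
  rintro _ ⟨l', rfl⟩
  exact (sq_le_sq₀ dist_nonneg dist_nonneg).1 (hle l')

open Program in
/-- The squared distance from the current item to the nearest center. -/
def minProg : Program :=
  forLoop 5 (nvar 2) (seq distProg
    (ite (.conj (.natLt (.lit 0) (nvar 5)) (.neg (.realLt (rvar 10) (rvar 9)))) skip
      (setReal 9 (.lit 0) (rvar 10))))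

theorem minProg_runs (he : Env d k M w s) (hC : Holds p C s) (hk : 0 < k) {i : ℕ} (hi : i < n)
    (h4 : s.nats 4 0 = i) :
    Runs ω minProg s ((k + 1) * (200 * (d + 1))) fun s' =>
      s'.reals 9 0 = Metric.infDist (p ⟨i, hi⟩) (Set.range C) ^ 2 := by
  refine Runs.mono (Runs.forLoop (T := 100 * (d + 1) + 50) k
    -- For `L = 0` both halves are vacuous: cell 9 still holds a stale value, which the program
    -- overwrites unconditionally at the first center.
    (fun L s' => (∀ l : Fin k, l < L → s'.reals 9 0 ≤ dist (p ⟨i, hi⟩) (C l) ^ 2) ∧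
      (0 < L → ∃ l : Fin k, l < L ∧ s'.reals 9 0 = dist (p ⟨i, hi⟩) (C l) ^ 2))
    ⟨by simp, by simp⟩ ?_ (by decide) ?_) ?_ ?_
  · intro s' hs
    simp [NatExpr.eval, hs.nats 2 (by decide), he.k_eq]
  · rintro l hl s₁ hs h5 ⟨hle, hex⟩
    refine Runs.mono (Runs.seq (T' := 50) ((distProg_runs (ω := ω)
      (he.of_same hs (by decide) (by decide)) (hC.of_same hs (by decide)) hi hl
      (by rw [hs.nats 4 (by decide), h4]) h5).same.mono le_rfl ?_)) (by omega) fun _ h => h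
    rintro s₂ ⟨h10, hs₂⟩
    have h9 : s₂.reals 9 = s₁.reals 9 := hs₂.reals 9 (by decide)
    refine Runs.mono (Runs.ite (T := 10) (fun hb => Runs.skip (by simp) ?_) fun hb =>
      Runs.setReal (by simp [NatExpr.cost, RealExpr.cost]) ?_)
      (by simp [NatExpr.cost, RealExpr.cost, Test.cost]) fun _ h => h
    · simp only [Test.Holds, NatExpr.eval, RealExpr.eval, hs₂.nats 5 (by decide), h5, h10, h9,
        not_lt] at hb
      simp only [State.writeNat_reals, h9]
      refine ⟨fun l' hl' => ?_, fun _ => ?_⟩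
      · rcases Nat.lt_succ_iff_lt_or_eq.1 hl' with h | rfl
        · exact hle l' h
        · exact hb.2
      · obtain ⟨l', hl', h⟩ := hex hb.1
        exact ⟨l', by omega, h⟩
    · simp only [Test.Holds, NatExpr.eval, RealExpr.eval, hs₂.nats 5 (by decide), h5, h10, h9,
        not_and, not_lt, not_le] at hb
      simp only [State.writeNat_reals, State.writeReal_reals, NatExpr.eval, RealExpr.eval, h10,
        if_true]
      refine ⟨fun l' hl' => ?_, fun _ => ⟨⟨l, hl⟩, by simp, rfl⟩⟩
      rcases Nat.lt_succ_iff_lt_or_eq.1 hl' with h | rfl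
      · exact (hb (by omega)).le.trans (hle l' h)
      · exact le_rfl
  · simp only [NatExpr.cost]
    gcongr
    omega
  · rintro s' ⟨hle, hex⟩
    obtain ⟨l, -, h⟩ := hex hk
    exact infDist_sq_eq_of_forall_le (fun l => hle l l.2) ⟨l, h⟩

open Program in
/-- Compute the cost of the current centers and the sampling weights. -/
def evalProg : Program :=
  seq (setReal 7 (.lit 0) (.lit 0)) (seq
    (forLoop 4 (nvar 0) (seq minProg (seq
      (setReal 4 (nvar 4) (.mul (.get 1 (nvar 4)) (rvar 9)))
      (setReal 7 (.lit 0) (.add (rvar 7) (.get 4 (nvar 4)))))))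
    (seq (setReal 13 (.lit 0) (rvar 7)) (forLoop 5 (nvar 2) (seq
      (setReal 4 (.add (nvar 0) (nvar 5)) (rvar 7))
      (setReal 13 (.lit 0) (.add (rvar 13) (rvar 7)))))))

theorem sum_mass_eq_cost : ∑ i ∈ Finset.range n, mass p w C i = kMeansCost p w C := by
  rw [Finset.sum_range]
  simp [mass, kMeansCost]

theorem evalProg_runs (he : Env d k M w s) (hC : Holds p C s) (hk : 0 < k) :
    Runs ω evalProg s ((n + 1) * ((k + 1) * (300 * (d + 1)))) fun s' =>
      s'.reals 7 0 = kMeansCost p w C ∧ s'.reals 13 0 = (k + 1) * kMeansCost p w C ∧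
      ∀ i < n + k, s'.reals 4 i = mass p w C i := by
  refine Runs.mono (Runs.seq (T := 3) (Runs.setReal (by simp [NatExpr.cost, RealExpr.cost])
    (Runs.bind (Runs.forLoop (T := (k + 1) * (200 * (d + 1)) + 20) n
    (fun i s' => s'.reals 7 0 = ∑ i' ∈ Finset.range i, mass p w C i' ∧
      ∀ i' < i, s'.reals 4 i' = mass p w C i') ?_ ?_ (by decide) ?_) (T' := 5 + (k + 1) * 50) ?_)))
    ?_ fun _ h => h
  · simp [State.writeReal_reals, NatExpr.eval, RealExpr.eval]
  · intro s' hs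
    simp [NatExpr.eval, hs.nats 0 (by decide), he.n_eq]
  · rintro i hi s₁ hs h4 ⟨h7, hm⟩
    have hs' : Same evalProg s s₁ := Same.trans (Same.writeReal _ _ _ (by decide))
      (hs.mono (by decide) (by decide) (by decide))
    have he₁ := he.of_same hs' (by decide) (by decide)
    refine Runs.bind (T' := 20) (minProg_runs he₁ (hC.of_same hs' (by decide)) hk hi h4) ?_
    intro s₂ hs₂ h9
    have he₂ := he₁.of_same hs₂ (by decide) (by decide)
    have h4' : s₂.nats 4 0 = i := by rw [hs₂.nats 4 (by decide), h4]
    refine Runs.mono (Runs.seq (T := 10) (T' := 10) (Runs.setReal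
      (by simp [NatExpr.cost, RealExpr.cost])
      (Runs.setReal (by simp [NatExpr.cost, RealExpr.cost]) ?_))) (by simp) fun _ h => h
    have hmi : mass p w C i = s₂.reals 1 i * s₂.reals 9 0 := by
      rw [h9, he₂.w_eq ⟨i, hi⟩]; simp [mass, hi]
    refine ⟨?_, fun i' hi' => ?_⟩
    · rw [Finset.sum_range_succ, ← h7, hmi]
      simp [State.writeReal_reals, NatExpr.eval, RealExpr.eval, h4',
        State.writeReal_reals_ne, hs₂.reals 7 (by decide)]
    · simp only [State.writeNat_reals, State.writeReal_reals, NatExpr.eval, RealExpr.eval, h4',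
        State.writeReal_nats, State.writeReal_reals_ne _ _ _ (show 4 ≠ 7 by decide)]
      split_ifs with h
      · rw [h, hmi]
      · rw [hs₂.reals 4 (by decide)]
        exact hm i' (by omega)
  · rintro s₁ hs ⟨h7, hm⟩
    have hs' : Same evalProg s s₁ := Same.trans (Same.writeReal _ _ _ (by decide))
      (hs.mono (by decide) (by decide) (by decide))
    have he₁ := he.of_same hs' (by decide) (by decide)
    rw [sum_mass_eq_cost] at h7
    refine Runs.seq (Runs.setReal (by simp [NatExpr.cost, RealExpr.cost]) (Runs.mono
      (Runs.forLoop (T := 30) k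
        (fun l s' => s'.reals 7 0 = kMeansCost p w C ∧
          s'.reals 13 0 = (l + 1) * kMeansCost p w C ∧
          ∀ i < n + l, s'.reals 4 i = mass p w C i) ?_ ?_ (by decide) ?_) ?_ fun _ h => h))
    · simpa [State.writeReal_reals, NatExpr.eval, RealExpr.eval, h7,
        State.writeReal_reals_ne] using hm
    · intro s' hs
      simp [NatExpr.eval, hs.nats 2 (by decide), he₁.k_eq]
    · rintro l hl s₂ hs₂ h5 ⟨h7, h13, hm⟩
      have h0 : s₂.nats 0 0 = n := by
        rw [hs₂.nats 0 (by decide), State.writeReal_nats, he₁.n_eq]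
      refine Runs.mono (Runs.seq (T := 15) (T' := 15) (Runs.setReal
        (by simp [NatExpr.cost, RealExpr.cost])
        (Runs.setReal (by simp [NatExpr.cost, RealExpr.cost]) ?_))) (by simp) fun _ h => h
      refine ⟨?_, ?_, fun i hi => ?_⟩
      · simp [State.writeReal_reals_ne, h7]
      · simp [State.writeReal_reals_ne, State.writeReal_reals, h7, h13, NatExpr.eval, RealExpr.eval]
        ring
      · simp only [State.writeNat_reals, State.writeReal_reals, NatExpr.eval, RealExpr.eval, h5, h0,
          State.writeReal_reals_ne _ _ _ (show 4 ≠ 13 by decide)]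
        split_ifs with h
        · simp [h7, mass, h]
        · exact hm i (by omega)
    · simp [NatExpr.cost]
  · simp only [NatExpr.cost]
    nlinarith [Nat.zero_le n, Nat.zero_le (k * d), Nat.zero_le k, Nat.zero_le d,
      Nat.zero_le (n * k), Nat.zero_le (n * d), Nat.zero_le (n * (k * d))]

/-! ### The algorithm as a function of the tape, and its representation in memory -/

/-- The current centers of the algorithm and the best centers seen so far. -/
structure Conf (d k : ℕ) where
  cur : Fin k → EuclideanSpace ℝ (Fin d)
  out : Fin k → EuclideanSpace ℝ (Fin d)

open Classical in
/-- Record the current centers if they are better than the best ones so far. -/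
def Conf.keep (p : Fin n → EuclideanSpace ℝ (Fin d)) (w : Fin n → ℝ) (x : Conf d k) : Conf d k :=
  ⟨x.cur, if kMeansCost p w x.cur < kMeansCost p w x.out then x.cur else x.out⟩

/-- The mean of `M` items drawn with the samples `ω 0, …, ω (M - 1)`. -/
def newCenter (p : Fin n → EuclideanSpace ℝ (Fin d)) (w : Fin n → ℝ) (M : ℕ)
    (C : Fin k → EuclideanSpace ℝ (Fin d)) (ω : Tape) : EuclideanSpace ℝ (Fin d) :=
  (M : ℝ)⁻¹ • ∑ q ∈ Finset.range M, items p C (drawIndex p w C (ω q))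

/-- Replace the center number `t`. -/
def setCenter (C : Fin k → EuclideanSpace ℝ (Fin d)) (t : ℕ) (y : EuclideanSpace ℝ (Fin d)) :
    Fin k → EuclideanSpace ℝ (Fin d) :=
  fun l => if (l : ℕ) = t then y else C l

/-- One step of the algorithm: record the current centers and resample the center number `t`. -/
def Conf.step (p : Fin n → EuclideanSpace ℝ (Fin d)) (w : Fin n → ℝ) (M t : ℕ) (x : Conf d k)
    (ω : Tape) : Conf d k :=
  ⟨setCenter x.cur t (newCenter p w M x.cur ω), (x.keep p w).out⟩

/-- `N` steps of the algorithm, starting with the center number `t`, and a final comparison. -/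
def Conf.iterate (p : Fin n → EuclideanSpace ℝ (Fin d)) (w : Fin n → ℝ) (M : ℕ) :
    ℕ → ℕ → Conf d k → Tape → Conf d k
  | 0, _, x, _ => x.keep p w
  | N + 1, t, x, ω => Conf.iterate p w M N (if t + 1 < k then t + 1 else 0) (x.step p w M t ω)
      fun q => ω (M + q)

/-- The memory holds the configuration `x`. -/
structure Repr (p : Fin n → EuclideanSpace ℝ (Fin d)) (w : Fin n → ℝ) (x : Conf d k) (s : State) :
    Prop where
  cur : Holds p x.cur s
  out : ∀ (l : Fin k) (j : Fin d), s.reals 3 (l * d + j) = x.out l j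
  best : s.reals 8 0 = kMeansCost p w x.out

theorem Repr.of_same {x : Conf d k} {P : Program} {s s' : State} (h : Repr p w x s)
    (hs : Same P s s') (hr : ∀ a ∈ [0, 3, 8], a ∉ P.realWrites) : Repr p w x s' := by
  simp only [List.mem_cons, List.not_mem_nil, or_false, forall_eq_or_imp, forall_eq] at hr
  exact ⟨h.cur.of_same hs hr.1, by rw [hs.reals _ hr.2.1]; exact h.out,
    by rw [hs.reals _ hr.2.2, h.best]⟩

/-- Uniqueness of division with remainder: distinct pairs of row and coordinate occupy distinct
cells, so writing one entry leaves the others intact. -/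
theorem eq_of_mul_add_eq {l l' : ℕ} {j j' : Fin d} (h : l * d + j = l' * d + j') :
    l = l' ∧ j = j' := by
  have hd : 0 < d := j.pos
  have h1 := congrArg (· / d) h
  simp only [Nat.mul_comm _ d, Nat.mul_add_div hd, Nat.div_eq_of_lt j.2, Nat.div_eq_of_lt j'.2,
    add_zero] at h1
  subst h1
  exact ⟨rfl, Fin.ext (by omega)⟩

open Program in
/-- Copy the current centers to the output array. -/
def copyProg : Program :=
  forLoop 5 (nvar 2) (forLoop 6 (nvar 1) (setReal 3 (.add (.mul (nvar 5) (nvar 1)) (nvar 6))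
    (.get 0 (.add (.mul (.add (nvar 0) (nvar 5)) (nvar 1)) (nvar 6)))))

theorem copyProg_runs (he : Env d k M w s) (hC : Holds p C s) :
    Runs ω copyProg s ((k + 1) * (100 * (d + 1))) fun s' =>
      ∀ (l : Fin k) (j : Fin d), s'.reals 3 (l * d + j) = C l j := by
  refine Runs.mono (Runs.forLoop (T := (d + 1) * 50) k
    (fun L s' => ∀ (l : Fin k) (j : Fin d), (l : ℕ) < L → s'.reals 3 (l * d + j) = C l j)
    (by simp) ?_ (by decide) ?_) ?_ fun s' h l j => h l j l.2
  · intro s' hs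
    simp [NatExpr.eval, hs.nats 2 (by decide), he.k_eq]
  · intro L hL s₁ hs₁ h5 hinv
    have he₁ := he.of_same hs₁ (by decide) (by decide)
    have hC₁ := hC.of_same hs₁ (by decide)
    refine Runs.mono (Runs.forLoop (T := 30) d
      -- The inner invariant is lexicographic: the rows before `L` are complete and row `L` is
      -- filled up to `J`.
      (fun J s' => ∀ (l : Fin k) (j : Fin d), (l : ℕ) < L ∨ (l : ℕ) = L ∧ (j : ℕ) < J →
        s'.reals 3 (l * d + j) = C l j) ?_ ?_ (by decide) ?_) ?_ ?_
    · intro l j h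
      simpa using hinv l j (by simpa using h)
    · intro s' hs
      simp [NatExpr.eval, hs.nats 1 (by decide), he₁.d_eq]
    · intro J hJ s₂ hs₂ h6 hinv₂
      have he₂ := he₁.of_same hs₂ (by decide) (by decide)
      have hC₂ := hC₁.of_same hs₂ (by decide)
      refine Runs.setReal (by simp [NatExpr.cost, RealExpr.cost]) fun l j hlj => ?_
      simp only [State.writeNat_reals, State.writeReal_reals, NatExpr.eval, RealExpr.eval,
        hs₂.nats 5 (by decide), h5, he₂.n_eq, he₂.d_eq, h6]
      split_ifs with h
      · obtain ⟨h1, h2⟩ := eq_of_mul_add_eq (j' := ⟨J, hJ⟩) h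
        rw [hC₂ (n + L) (by omega) ⟨J, hJ⟩]
        simp [items, h2, ← h1]
      · refine hinv₂ l j ?_
        rcases hlj with h' | ⟨rfl, h'⟩
        · exact .inl h'
        · refine .inr ⟨rfl, lt_of_le_of_ne (by omega) ?_⟩
          rintro rfl; exact h rfl
    · simp [NatExpr.cost]
    · intro s' h l j hl
      exact h l j (by omega)
  · simp only [NatExpr.cost]
    gcongr
    omega

open Program in
/-- Record the current centers if they are better than the best ones so far. -/
def saveProg : Program :=
  ite (.realLt (rvar 7) (rvar 8)) (seq (setReal 8 (.lit 0) (rvar 7)) copyProg) skip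

theorem saveProg_runs (he : Env d k M w s) {x : Conf d k} (hx : Repr p w x s)
    (h7 : s.reals 7 0 = kMeansCost p w x.cur) :
    Runs ω saveProg s ((k + 1) * (100 * (d + 1)) + 30) (Repr p w (x.keep p w)) := by
  refine Runs.mono (Runs.ite (T := 5 + (k + 1) * (100 * (d + 1))) (fun hb => Runs.seq
    (Runs.setReal (by simp [NatExpr.cost, RealExpr.cost]) ?_)) fun hb => Runs.skip (by omega) ?_)
    (by simp [NatExpr.cost, RealExpr.cost, Test.cost]; omega) fun _ h => h
  · simp only [Test.Holds, RealExpr.eval, NatExpr.eval, h7, hx.best] at hb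
    have hs : Same saveProg s (s.writeReal 8 0 (s.reals 7 0)) := Same.writeReal _ _ _ (by decide)
    refine (copyProg_runs (he.of_same hs (by decide) (by decide))
      (hx.cur.of_same hs (by decide))).same.mono le_rfl fun s' ⟨h, hs'⟩ => ?_
    refine ⟨(hx.cur.of_same hs (by decide)).of_same hs' (by decide), ?_, ?_⟩
    · simpa [Conf.keep, hb] using h
    · rw [hs'.reals 8 (by decide)]
      simp [State.writeReal_reals, Conf.keep, hb, h7]
  · simp only [Test.Holds, RealExpr.eval, NatExpr.eval, h7, hx.best] at hb
    simpa [Conf.keep, hb] using hx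

/-! ### Drawing items and resampling a center -/

open Program in
/-- Draw an item at random. -/
def drawProg : Program :=
  seq (sample 12 (.lit 0)) (seq (setReal 12 (.lit 0) (.mul (rvar 12) (rvar 13)))
    (seq (setReal 11 (.lit 0) (.lit 0)) (seq (setNat 7 (.lit 0) (.lit 0))
    (forLoop 4 (.add (nvar 0) (nvar 2)) (seq
      (ite (.realLt (rvar 12) (rvar 11)) skip (setNat 7 (.lit 0) (nvar 4)))
      (setReal 11 (.lit 0) (.add (rvar 11) (.get 4 (nvar 4)))))))))

theorem drawProg_runs (he : Env d k M w s) (h4 : ∀ i < n + k, s.reals 4 i = mass p w C i)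
    (h13 : s.reals 13 0 = (k + 1) * kMeansCost p w C) :
    Runs ω drawProg s ((n + k + 1) * 200) fun s' =>
      s'.nats 7 0 = drawIndex p w C (ω s.used) ∧ s'.used = s.used + 1 := by
  set v : ℝ := ω s.used * ((k + 1) * kMeansCost p w C)
  refine Runs.mono (Runs.seq (T := 5) (Runs.sample (by simp [NatExpr.cost]) (Runs.seq (T := 10)
    (Runs.setReal (by simp [NatExpr.cost, RealExpr.cost]) (Runs.seq (T := 5)
    (Runs.setReal (by simp [NatExpr.cost, RealExpr.cost]) (Runs.seq (T := 5)
    (Runs.setNat (by simp [NatExpr.cost])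
    (Runs.mono (Runs.forLoop (T := 60) (n + k) (fun i s' => s'.reals 12 0 = v ∧
      s'.reals 11 0 = ∑ i' ∈ Finset.range i, mass p w C i' ∧
      s'.nats 7 0 = pick (mass p w C) v i ∧ s'.used = s.used + 1) ?_ ?_ (by decide) ?_)
      le_rfl fun _ h => ⟨h.2.2.1, h.2.2.2⟩))))))))) ?_ fun _ h => h
  · simp [State.writeReal_reals, State.writeReal_reals_ne, NatExpr.eval, RealExpr.eval,
      State.writeNat_nats_self, State.writeNat_nats_ne, pick, h13, v]
  · intro s' hs
    simp [NatExpr.eval, hs.nats 0 (by decide), hs.nats 2 (by decide), State.writeNat_nats_ne]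
    rw [he.n_eq, he.k_eq]
  · rintro i hi s₁ hs hi4 ⟨h12, h11, h7, hu⟩
    refine Runs.mono (Runs.bind (T' := 15) (Runs.ite (T := 10)
      (Q := fun s' => s'.nats 7 0 = pick (mass p w C) v (i + 1) ∧ s'.used = s.used + 1)
      (fun hb => Runs.skip (by simp) ?_)
      fun hb => Runs.setNat (by simp [NatExpr.cost]) ?_) ?_) ?_ fun _ h => h
    · simp only [Test.Holds, RealExpr.eval, NatExpr.eval, h12, h11] at hb
      simp [pick, hb, h7, hu]
    · simp only [Test.Holds, RealExpr.eval, NatExpr.eval, h12, h11] at hb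
      simp [pick, hb, NatExpr.eval, hi4, hu, State.writeNat_nats_self]
    · rintro s₂ hs₂ ⟨h7', hu'⟩
      refine Runs.setReal (by simp [NatExpr.cost, RealExpr.cost]) ?_
      have hr : s₂.reals = s₁.reals := funext fun a => hs₂.reals a (by simp [Program.realWrites])
      have h4' : s₁.reals 4 i = mass p w C i := by
        rw [hs.reals 4 (by decide), ← h4 i hi]
        simp [State.writeReal_reals_ne]
      simp [State.writeReal_reals, State.writeReal_reals_ne, NatExpr.eval, RealExpr.eval, hr, h12,
        h11, h7', hu', State.writeNat_nats_ne, hs₂.nats 4 (by decide), hi4,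
        Finset.sum_range_succ, h4']
    · simp [NatExpr.cost, RealExpr.cost, Test.cost]
  · simp only [NatExpr.cost]
    omega

/-- Nothing is assumed about `m` and `v`, so the index stays valid in the degenerate cases of total
mass zero and of a sample equal to 1. -/
theorem pick_le (m : ℕ → ℝ) (v : ℝ) (N : ℕ) : pick m v N ≤ N - 1 := by
  induction N with
  | zero => simp [pick]
  | succ N ih =>
    rw [pick]
    split_ifs <;> omega

theorem drawIndex_lt (hn : 0 < n) (r : ℝ) : drawIndex p w C r < n + k :=
  (pick_le _ _ _).trans_lt (by omega)

open Program in
/-- Clear the accumulator. -/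
def clearProg : Program := forLoop 6 (nvar 1) (setReal 6 (nvar 6) (.lit 0))

theorem clearProg_runs (he : Env d k M w s) :
    Runs ω clearProg s ((d + 1) * 30) fun s' => ∀ j < d, s'.reals 6 j = 0 := by
  refine Runs.mono (Runs.forLoop (T := 10) d (fun J s' => ∀ j < J, s'.reals 6 j = 0)
    (by simp) ?_ (by decide) ?_) ?_ fun _ h => h
  · intro s' hs
    simp [NatExpr.eval, hs.nats 1 (by decide), he.d_eq]
  · intro J hJ s₁ hs h6 hinv
    refine Runs.setReal (by simp [NatExpr.cost, RealExpr.cost]) fun j hj => ?_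
    simp only [State.writeNat_reals, State.writeReal_reals, NatExpr.eval, RealExpr.eval, h6]
    split_ifs with h
    · simp
    · exact hinv j (by omega)
  · simp [NatExpr.cost]

open Program in
/-- Add the drawn item to the accumulator. -/
def addProg : Program :=
  forLoop 6 (nvar 1) (setReal 6 (nvar 6)
    (.add (.get 6 (nvar 6)) (.get 0 (.add (.mul (nvar 7) (nvar 1)) (nvar 6)))))

theorem addProg_runs (he : Env d k M w s) (hC : Holds p C s) {i : ℕ} (hi : i < n + k)
    (h7 : s.nats 7 0 = i) :
    Runs ω addProg s ((d + 1) * 50) fun s' =>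
      ∀ j : Fin d, s'.reals 6 j = s.reals 6 j + items p C i j := by
  refine Runs.mono (Runs.forLoop (T := 30) d
    (fun J s' => ∀ j : Fin d, s'.reals 6 j = s.reals 6 j + if (j : ℕ) < J then items p C i j else 0)
    (by simp) ?_ (by decide) ?_) ?_ fun s' h j => by simpa using h j
  · intro s' hs
    simp [NatExpr.eval, hs.nats 1 (by decide), he.d_eq]
  · intro J hJ s₁ hs h6 hinv
    have he₁ := he.of_same hs (by decide) (by decide)
    refine Runs.setReal (by simp [NatExpr.cost, RealExpr.cost]) fun j => ?_
    simp only [State.writeNat_reals, State.writeReal_reals, NatExpr.eval, RealExpr.eval, h6,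
      hs.nats 7 (by decide), h7, he₁.d_eq, hs.reals 0 (by decide)]
    split_ifs with h h' h'
    · subst h
      rw [hinv j, hC i hi j]
      simp
    · omega
    · rw [hinv j, if_pos (by omega)]
    · rw [hinv j, if_neg (by omega)]
  · simp [NatExpr.cost]

open Program in
/-- Store the mean of the drawn items as the current center. -/
def storeProg : Program :=
  forLoop 6 (nvar 1) (setReal 0 (.add (.mul (.add (nvar 0) (nvar 9)) (nvar 1)) (nvar 6))
    (.div (.get 6 (nvar 6)) (rvar 5)))

theorem storeProg_runs (he : Env d k M w s) (hC : Holds p C s) {t : ℕ} (h9 : s.nats 9 0 = t)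
    {y : EuclideanSpace ℝ (Fin d)} (hy : ∀ j : Fin d, s.reals 6 j = y j) :
    Runs ω storeProg s ((d + 1) * 50) (Holds p (setCenter C t ((M : ℝ)⁻¹ • y))) := by
  have hitem : ∀ i < n + k, i ≠ n + t →
      items p (setCenter C t ((M : ℝ)⁻¹ • y)) i = items p C i := by
    intro i hi hit
    simp only [items, setCenter]
    split_ifs <;> first | rfl | omega
  refine Runs.mono (Runs.forLoop (T := 30) d
    (fun J s' => ∀ i < n + k, ∀ j : Fin d, s'.reals 0 (i * d + j) =
      if i = n + t ∧ (j : ℕ) < J then (M : ℝ)⁻¹ * y j else items p C i j)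
    (by simpa [Holds] using hC) ?_ (by decide) ?_) ?_ ?_
  · intro s' hs
    simp [NatExpr.eval, hs.nats 1 (by decide), he.d_eq]
  · intro J hJ s₁ hs h6 hinv
    refine Runs.setReal (by simp [NatExpr.cost, RealExpr.cost]) fun i hi j => ?_
    simp only [State.writeNat_reals, State.writeReal_reals, NatExpr.eval, RealExpr.eval, h6,
      hs.nats 9 (by decide), h9, hs.nats 1 (by decide), he.d_eq, hs.nats 0 (by decide), he.n_eq,
      hs.reals 6 (by decide), hs.reals 5 (by decide), he.M_real]
    split_ifs with h h' h'
    · obtain ⟨-, h2⟩ := eq_of_mul_add_eq (j' := ⟨J, hJ⟩) h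
      rw [hy ⟨J, hJ⟩, h2]
      ring
    · obtain ⟨h1, h2⟩ := eq_of_mul_add_eq (j' := ⟨J, hJ⟩) h
      exact absurd ⟨h1, by simp [h2]⟩ h'
    · rw [hinv i hi j, if_pos ⟨h'.1, lt_of_le_of_ne (by omega) fun e => h (by rw [h'.1, e])⟩]
    · rw [hinv i hi j, if_neg fun h'' => h' ⟨h''.1, by omega⟩]
  · simp [NatExpr.cost]
  · intro s' h i hi j
    rw [h i hi j]
    by_cases hit : i = n + t
    · subst hit
      simp [items, setCenter, show t < k by omega]
    · rw [hitem i hi hit]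
      simp [hit]

open Program in
/-- Replace the current center by the mean of `M` drawn items. -/
def resampleProg : Program :=
  seq clearProg (seq (forLoop 8 (nvar 3) (seq drawProg addProg)) storeProg)

theorem resampleProg_runs (hn : 0 < n) (he : Env d k M w s) (hC : Holds p C s) {t : ℕ}
    (h9 : s.nats 9 0 = t) (h4 : ∀ i < n + k, s.reals 4 i = mass p w C i)
    (h13 : s.reals 13 0 = (k + 1) * kMeansCost p w C) :
    Runs ω resampleProg s ((M + 1) * ((n + k + 1) * 200 + (d + 1) * 200)) fun s' =>
      Holds p (setCenter C t (newCenter p w M C fun q => ω (s.used + q))) s' ∧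
        s'.used = s.used + M := by
  refine Runs.mono (Runs.bind (T' := (M + 1) * ((n + k + 1) * 200 + (d + 1) * 50 + 17) +
    (d + 1) * 50) (clearProg_runs he) fun s₁ hs₁ h6 => ?_) ?_ fun _ h => h
  · have he₁ := he.of_same hs₁ (by decide) (by decide)
    have hC₁ := hC.of_same hs₁ (by decide)
    refine Runs.bind (Runs.mono (Runs.forLoop (T := (n + k + 1) * 200 + (d + 1) * 50) M
      (fun m s' => s'.used = s.used + m ∧ ∀ j : Fin d, s'.reals 6 j =
        (∑ q ∈ Finset.range m, items p C (drawIndex p w C (ω (s.used + q)))) j) ?_ ?_ (by decide) ?_)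
      ?_ fun _ h => h) ?_
    · exact ⟨hs₁.used rfl, fun j => by simpa using h6 j j.2⟩
    · intro s' hs
      simp [NatExpr.eval, hs.nats 3 (by decide), he₁.M_eq]
    · rintro m hm s₂ hs₂ - ⟨hu, hsum⟩
      have he₂ := he₁.of_same hs₂ (by decide) (by decide)
      have hC₂ := hC₁.of_same hs₂ (by decide)
      refine Runs.bind (drawProg_runs (p := p) (C := C) he₂
        (by rw [hs₂.reals 4 (by decide), hs₁.reals 4 (by decide)]; exact h4)
        (by rw [hs₂.reals 13 (by decide), hs₁.reals 13 (by decide)]; exact h13)) ?_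
      rintro s₃ hs₃ ⟨h7, hu₃⟩
      refine (addProg_runs (he₂.of_same hs₃ (by decide) (by decide)) (hC₂.of_same hs₃ (by decide))
        (drawIndex_lt hn _) h7).same.mono le_rfl ?_
      rintro s₄ ⟨h6', hs₄⟩
      refine ⟨by rw [State.writeNat_used, hs₄.used rfl, hu₃, hu]; rfl, fun j => ?_⟩
      rw [State.writeNat_reals, h6' j, hs₃.reals 6 (by decide), hsum j, Finset.sum_range_succ, hu]
      simp
    · simp only [NatExpr.cost]
      exact Nat.mul_le_mul_left _ (by omega)
    · rintro s₂ hs₂ ⟨hu, hsum⟩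
      refine (storeProg_runs (he₁.of_same hs₂ (by decide) (by decide)) (hC₁.of_same hs₂ (by decide))
        (t := t) (by rw [hs₂.nats 9 (by decide), hs₁.nats 9 (by decide), h9]) hsum).same.mono le_rfl ?_
      rintro s₃ ⟨h, hs₃⟩
      exact ⟨h, by rw [hs₃.used rfl, hu]⟩
  · nlinarith [Nat.zero_le (M * d), Nat.zero_le (M * n), Nat.zero_le (M * k)]

open Program in
/-- One step of the algorithm. -/
def stepProg : Program :=
  seq evalProg (seq saveProg (seq resampleProg (seq
    (setNat 9 (.lit 0) (.add (nvar 9) (.lit 1)))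
    (ite (.natLt (nvar 9) (nvar 2)) skip (setNat 9 (.lit 0) (.lit 0))))))

theorem stepProg_runs (hn : 0 < n) (hk : 0 < k) (he : Env d k M w s) {x : Conf d k}
    (hx : Repr p w x s) {t : ℕ} (h9 : s.nats 9 0 = t) :
    Runs ω stepProg s (1500 * ((n + 1) * (k + 1) * (d + 1) * (M + 1))) fun s' =>
      Repr p w (x.step p w M t fun q => ω (s.used + q)) s' ∧ s'.used = s.used + M ∧
        s'.nats 9 0 = if t + 1 < k then t + 1 else 0 := by
  refine Runs.mono (Runs.bind (evalProg_runs (p := p) he hx.cur hk) (T' := (k + 1) * (100 * (d + 1)) + 30 +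
    ((M + 1) * ((n + k + 1) * 200 + (d + 1) * 200) + (10 + 20))) fun s₁ hs₁ ⟨h7, h13, h4⟩ => ?_) ?_ fun _ h => h
  · have he₁ := he.of_same hs₁ (by decide) (by decide)
    have hx₁ := hx.of_same hs₁ (by decide)
    refine Runs.bind (saveProg_runs he₁ hx₁ h7) fun s₂ hs₂ hx₂ => ?_
    have he₂ := he₁.of_same hs₂ (by decide) (by decide)
    refine Runs.bind (resampleProg_runs hn he₂ hx₂.cur (t := t)
      (by rw [hs₂.nats 9 (by decide), hs₁.nats 9 (by decide), h9])
      (by rw [hs₂.reals 4 (by decide)]; exact h4)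
      (by rw [hs₂.reals 13 (by decide)]; exact h13)) ?_
    rintro s₃ hs₃ ⟨hC₃, hu₃⟩
    have he₃ := he₂.of_same hs₃ (by decide) (by decide)
    rw [hs₂.used rfl, hs₁.used rfl] at hC₃ hu₃
    have h9₃ : s₃.nats 9 0 = t := by
      rw [hs₃.nats 9 (by decide), hs₂.nats 9 (by decide), hs₁.nats 9 (by decide), h9]
    have hR : Repr p w (x.step p w M t fun q => ω (s.used + q)) s₃ :=
      ⟨hC₃, by rw [hs₃.reals 3 (by decide)]; exact hx₂.out,
        by rw [hs₃.reals 8 (by decide)]; exact hx₂.best⟩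
    refine Runs.seq (Runs.setNat (by simp [NatExpr.cost]) (Runs.mono (Runs.ite (T := 10)
      (fun hb => Runs.skip (by simp) ?_) (fun hb => Runs.setNat (by simp [NatExpr.cost]) ?_))
      (by simp [NatExpr.cost, Test.cost]) fun _ h => h))
    · simp only [Test.Holds, NatExpr.eval, State.writeNat_nats_self, h9₃,
        State.writeNat_nats_ne _ _ _ (show 2 ≠ 9 by decide), he₃.k_eq] at hb
      refine ⟨⟨hR.cur, hR.out, hR.best⟩, hu₃, ?_⟩
      simp [State.writeNat_nats_self, NatExpr.eval, h9₃, hb]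
    · simp only [Test.Holds, NatExpr.eval, State.writeNat_nats_self, h9₃,
        State.writeNat_nats_ne _ _ _ (show 2 ≠ 9 by decide), he₃.k_eq] at hb
      refine ⟨⟨hR.cur, hR.out, hR.best⟩, hu₃, ?_⟩
      simp [State.writeNat_nats_self, NatExpr.eval, hb]
  · have h1 : (n + 1) * ((k + 1) * (300 * (d + 1))) ≤
        300 * ((n + 1) * (k + 1) * (d + 1) * (M + 1)) := by
      calc _ = 300 * ((n + 1) * (k + 1) * (d + 1) * 1) := by ring
        _ ≤ _ := by gcongr; omega
    have h2 : (k + 1) * (100 * (d + 1)) ≤ 100 * ((n + 1) * (k + 1) * (d + 1) * (M + 1)) := by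
      calc _ = 100 * (1 * (k + 1) * (d + 1) * 1) := by ring
        _ ≤ _ := by gcongr <;> omega
    have h3 : (M + 1) * ((n + k + 1) * 200) ≤ 400 * ((n + 1) * (k + 1) * (d + 1) * (M + 1)) := by
      calc _ ≤ (M + 1) * (2 * ((n + 1) * (k + 1)) * 200) := by
            gcongr; nlinarith [Nat.zero_le (n * k)]
        _ = 400 * ((n + 1) * (k + 1) * 1 * (M + 1)) := by ring
        _ ≤ _ := by gcongr; omega
    have h4 : (M + 1) * ((d + 1) * 200) ≤ 200 * ((n + 1) * (k + 1) * (d + 1) * (M + 1)) := by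
      calc _ = 200 * (1 * 1 * (d + 1) * (M + 1)) := by ring
        _ ≤ _ := by gcongr <;> omega
    have h5 : 1 * 1 * 1 * 1 ≤ (n + 1) * (k + 1) * (d + 1) * (M + 1) := by gcongr <;> omega
    rw [Nat.mul_add (M + 1)]
    omega

/-! ### Choice of the parameters, and the complete run -/

open Program in
/-- Compute the number of items drawn for one center. -/
def sizeProg : Program :=
  loop (.realLt (.mul (rvar 5) (rvar 2)) (.lit 100))
    (seq (setReal 5 (.lit 0) (.add (rvar 5) (.lit 1)))
      (setNat 3 (.lit 0) (.add (nvar 3) (.lit 1))))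

/-- Reals cannot be rounded, so the ceiling is found by counting up until the counter times `ε`
reaches 100. The counter is kept both as a natural number, for loop bounds, and as a real, for the
division in the mean. -/
theorem sizeProg_runs {ε : ℝ} (hε : 0 < ε) (h2 : s.reals 2 0 = ε) (he : Env d k 0 w s) :
    Runs ω sizeProg s ((⌈100 / ε⌉₊ + 1) * 50) (Env d k ⌈100 / ε⌉₊ w) := by
  set N := ⌈100 / ε⌉₊
  refine (Runs.mono (Runs.loop (T := 20) N (fun i s' => s'.reals 5 0 = i ∧ s'.nats 3 0 = i ∧
    s'.reals 2 0 = ε) ?_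
    ?_ ?_) (T' := (N + 1) * 50) ?_ fun _ h => h).same.mono le_rfl ?_
  · exact ⟨he.M_real, he.M_eq, h2⟩
  · rintro i hi s₁ hs ⟨h5, h3, h2⟩
    refine ⟨?_, Runs.mono (Runs.seq (T := 10) (T' := 10)
      (Runs.setReal (by simp [NatExpr.cost, RealExpr.cost])
      (Runs.setNat (by simp [NatExpr.cost]) ?_))) (by simp) fun _ h => h⟩
    · simpa [Test.Holds, RealExpr.eval, NatExpr.eval, h5, h2] using
        (lt_div_iff₀ hε).1 (Nat.lt_ceil.1 hi)
    · simp [State.writeReal_reals, NatExpr.eval, RealExpr.eval, h5, h3, h2, State.writeNat_nats_self,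
        State.writeReal_reals_ne]
  · rintro s' ⟨h5, -, h2⟩
    simpa [Test.Holds, RealExpr.eval, NatExpr.eval, h5, h2] using
      (div_le_iff₀ hε).1 (Nat.le_ceil (100 / ε))
  · simp only [Test.cost, RealExpr.cost, NatExpr.cost]
    omega
  · rintro s' ⟨⟨h5, h3, -⟩, hs⟩
    exact ⟨by rw [hs.nats 0 (by decide), he.n_eq], by rw [hs.nats 1 (by decide), he.d_eq],
      by rw [hs.nats 2 (by decide), he.k_eq], h3, by rw [hs.reals 1 (by decide)]; exact he.w_eq, h5⟩

/-- The number of trials made by the algorithm. -/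
def trials (k M : ℕ) : ℕ := (2 * (M * M) * (k * (k + 1))) ^ (M * k)

open Program in
/-- Compute the number of trials. -/
def trialsProg : Program :=
  seq (setNat 11 (.lit 0) (.lit 1)) (forLoop 12 (.mul (nvar 3) (nvar 2))
    (setNat 11 (.lit 0) (.mul (nvar 11) (.mul (.mul (.lit 2) (.mul (nvar 3) (nvar 3)))
      (.mul (nvar 2) (.add (nvar 2) (.lit 1)))))))

theorem trialsProg_runs (he : Env d k M w s) :
    Runs ω trialsProg s ((M * k + 1) * 80) fun s' => s'.nats 11 0 = trials k M := by
  refine Runs.mono (Runs.seq (T := 5) (Runs.setNat (by simp [NatExpr.cost])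
    (Runs.forLoop (T := 40) (M * k)
    (fun i s' => s'.nats 11 0 = (2 * (M * M) * (k * (k + 1))) ^ i) ?_ ?_ (by decide) ?_))) ?_
    fun _ h => h
  · simp [State.writeNat_nats_self, State.writeNat_nats_ne, NatExpr.eval]
  · intro s' hs
    simp [NatExpr.eval, hs.nats 3 (by decide), hs.nats 2 (by decide), State.writeNat_nats_ne,
      he.M_eq, he.k_eq]
  · intro i hi s₁ hs h12 h11
    refine Runs.setNat (by simp [NatExpr.cost]) ?_
    simp [NatExpr.eval, hs.nats 3 (by decide), hs.nats 2 (by decide), State.writeNat_nats_ne,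
      he.M_eq, he.k_eq, State.writeNat_nats_self, h11, pow_succ]
  · simp only [NatExpr.cost]
    omega

open Program in
/-- The whole algorithm. -/
def mainProg : Program :=
  seq sizeProg (seq trialsProg (seq evalProg (seq (setReal 8 (.lit 0) (rvar 7))
    (seq (forLoop 10 (.mul (nvar 11) (nvar 2)) stepProg) (seq evalProg saveProg)))))

/-- The initial configuration: all centers are at the origin. -/
def Conf.zero (d k : ℕ) : Conf d k := ⟨fun _ => 0, fun _ => 0⟩

theorem inputState_env {ε : ℝ} : Env d k 0 w (inputState k ε p w) := by
  constructor <;> simp [inputState]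

theorem inputState_holds {ε : ℝ} : Holds p (fun _ : Fin k => 0) (inputState k ε p w) := by
  intro i hi j
  have hd := j.pos
  by_cases h : i < n
  · have h1 : i * d + j < n * d := by
      calc i * d + j < i * d + d := by omega
        _ = (i + 1) * d := by ring
        _ ≤ n * d := Nat.mul_le_mul_right _ h
    have h2 : (i * d + j) / d = i := by
      rw [Nat.mul_comm, Nat.mul_add_div hd, Nat.div_eq_of_lt j.2, add_zero]
    have h3 : (i * d + j) % d = j := by
      rw [Nat.mul_comm, Nat.mul_add_mod, Nat.mod_eq_of_lt j.2]
    simp [inputState, items, h, h1, h2, h3]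
  · have h1 : ¬ i * d + j < n * d := by
      have := Nat.mul_le_mul_right d (not_lt.1 h)
      omega
    simp [inputState, items, h, h1]

theorem mainProg_runs (hn : 0 < n) (hk : 0 < k) {ε : ℝ} (hε : 0 < ε) :
    Runs ω mainProg (inputState k ε p w)
      (3000 * ((trials k ⌈100 / ε⌉₊ * k + 1) *
        ((n + 1) * (k + 1) * (d + 1) * (⌈100 / ε⌉₊ + 1)))) fun s' =>
      outputCenters d k s' = (Conf.iterate p w ⌈100 / ε⌉₊ (trials k ⌈100 / ε⌉₊ * k) 0
        (Conf.zero d k) ω).out := by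
  set M := ⌈100 / ε⌉₊
  set N := trials k M * k
  set U := (n + 1) * (k + 1) * (d + 1) * (M + 1)
  set E := (n + 1) * ((k + 1) * (300 * (d + 1)))
  refine Runs.mono (Runs.bind (T' := (M * k + 1) * 80 + (E + (10 + ((N + 1) * (1500 * U + 20) +
    (E + ((k + 1) * (100 * (d + 1)) + 30))))))
    (sizeProg_runs hε (by simp [inputState]) inputState_env) fun s₁ hs₁ he₁ => ?_) ?_ fun _ h => h
  · refine Runs.bind (trialsProg_runs he₁) fun s₂ hs₂ h11 => ?_
    have he₂ := he₁.of_same hs₂ (by decide) (by decide)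
    have hC₂ := ((inputState_holds (k := k) (p := p) (w := w) (ε := ε)).of_same hs₁
      (by decide)).of_same hs₂ (by decide)
    refine Runs.bind (evalProg_runs he₂ hC₂ hk) fun s₃ hs₃ ⟨h7, _, _⟩ =>
      Runs.seq (Runs.setReal (by simp [NatExpr.cost, RealExpr.cost]) ?_)
    have he₃ := he₂.of_same hs₃ (by decide) (by decide)
    have hC₃ := hC₂.of_same hs₃ (by decide)
    have he₄ : Env d k M w (s₃.writeReal 8 0 (s₃.reals 7 0)) :=
      he₃.of_same (Same.writeReal (P := saveProg) _ _ _ (by decide)) (by decide) (by decide)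
    have hx₄ : Repr p w (Conf.zero d k) (s₃.writeReal 8 0 (s₃.reals 7 0)) := by
      refine ⟨hC₃.of_same (Same.writeReal (P := saveProg) _ _ _ (by decide)) (by decide), ?_, ?_⟩
      · intro l j
        rw [State.writeReal_reals_ne _ _ _ (by decide), hs₃.reals 3 (by decide),
          hs₂.reals 3 (by decide), hs₁.reals 3 (by decide)]
        simp [inputState, Conf.zero]
      · simp [State.writeReal_reals, h7, Conf.zero]
    have hu₄ : (s₃.writeReal 8 0 (s₃.reals 7 0)).used = 0 := by
      rw [State.writeReal_used, hs₃.used rfl, hs₂.used rfl, hs₁.used rfl]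
      rfl
    -- Invariant: performing the remaining `N - i` steps on the unread part of the tape yields the
    -- result of the whole run.
    refine Runs.bind (Runs.mono (Runs.forLoop (T := 1500 * U) N (fun i s' => ∃ x t,
      Repr p w x s' ∧ s'.nats 9 0 = t ∧
      Conf.iterate p w M (N - i) t x (fun q => ω (s'.used + q)) =
        Conf.iterate p w M N 0 (Conf.zero d k) ω) ?_ ?_ (by decide) ?_) ?_ fun _ h => h) ?_
    · refine ⟨_, 0, ⟨hx₄.cur, hx₄.out, hx₄.best⟩, ?_, ?_⟩
      · rw [State.writeNat_nats_ne _ _ _ (by decide)]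
        simp only [NatExpr.eval, RealExpr.eval, State.writeReal_nats]
        rw [hs₃.nats 9 (by decide), hs₂.nats 9 (by decide), hs₁.nats 9 (by decide)]
        rfl
      · have : (fun q => ω ((State.writeNat (s₃.writeReal 8 0 (s₃.reals 7 0)) 10 0 0).used + q))
            = ω := by
          funext q
          rw [State.writeNat_used, hu₄, zero_add]
        exact congrArg _ this
    · intro s' hs
      simp only [NatExpr.eval]
      rw [hs.nats 11 (by decide), hs.nats 2 (by decide), State.writeReal_nats, he₃.k_eq,
        hs₃.nats 11 (by decide), h11]
    · rintro i hi s₅ hs₅ - ⟨x, t, hx, h9, hiter⟩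
      refine (stepProg_runs hn hk (he₄.of_same hs₅ (by decide) (by decide)) hx h9).mono le_rfl ?_
      rintro s₆ ⟨hx₆, hu₆, h9₆⟩
      refine ⟨_, _, ⟨hx₆.cur, hx₆.out, hx₆.best⟩,
        (congrFun (State.writeNat_nats_ne s₆ 0 (i + 1) (show 9 ≠ 10 by decide)) 0).trans h9₆, ?_⟩
      rw [← hiter, show N - i = N - (i + 1) + 1 by omega, Conf.iterate]
      simp only [State.writeNat_used, hu₆, add_assoc]
    · simp only [NatExpr.cost]
      exact Nat.mul_le_mul_left _ (by omega)
    · rintro s₅ hs₅ ⟨x, t, hx, -, hiter⟩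
      have he₅ := he₄.of_same hs₅ (by decide) (by decide)
      rw [Nat.sub_self, Conf.iterate] at hiter
      refine Runs.bind (evalProg_runs he₅ hx.cur hk) fun s₆ hs₆ ⟨h7, _, _⟩ => ?_
      refine (saveProg_runs (he₅.of_same hs₆ (by decide) (by decide))
        (hx.of_same hs₆ (by decide)) h7).mono le_rfl fun s₇ hx₇ => ?_
      rw [← hiter]
      funext l
      ext j
      exact hx₇.out l j
  · have hU : 1 * 1 * 1 * 1 ≤ U := by simp only [U]; gcongr <;> omega
    have h1 : (M + 1) * 50 ≤ 50 * U := by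
      calc _ = 50 * (1 * 1 * 1 * (M + 1)) := by ring
        _ ≤ _ := by simp only [U]; gcongr <;> omega
    have h2 : (M * k + 1) * 80 ≤ 80 * U := by
      calc _ ≤ 80 * (1 * (k + 1) * 1 * (M + 1)) := by nlinarith [Nat.zero_le k, Nat.zero_le M]
        _ ≤ _ := by simp only [U]; gcongr <;> omega
    have h3 : E ≤ 300 * U := by
      calc _ = 300 * ((n + 1) * (k + 1) * (d + 1) * 1) := by simp only [E]; ring
        _ ≤ _ := by simp only [U]; gcongr; omega
    have h4 : (k + 1) * (100 * (d + 1)) ≤ 100 * U := by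
      calc _ = 100 * (1 * (k + 1) * (d + 1) * 1) := by ring
        _ ≤ _ := by simp only [U]; gcongr <;> omega
    have h5 : U ≤ (N + 1) * U := Nat.le_mul_of_pos_left _ (by omega)
    have h6 : (N + 1) * (1500 * U + 20) ≤ 1520 * ((N + 1) * U) := by
      calc _ ≤ (N + 1) * (1500 * U + 20 * U) := by gcongr; omega
        _ = _ := by ring
    omega

end

end RealRAM

/-! ## Random choices made with the tape -/

namespace RealRAM

noncomputable section

instance : IsProbabilityMeasure tapeLaw := by
  unfold tapeLaw
  infer_instance

/-- Put one sample in front of a tape. -/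
def consTape (x : unitInterval × Tape) : Tape
  | 0 => x.1
  | i + 1 => x.2 i

theorem measurable_consTape : Measurable consTape := by
  refine measurable_pi_lambda _ fun i => ?_
  cases i with
  | zero => exact measurable_fst
  | succ i => exact (measurable_pi_apply i).comp measurable_snd

/-- This is the only form in which independence enters: the first sample and the rest of the tape
are independent, and the rest is again distributed as a tape. It is enough to compare the two
measures on boxes with finitely many constrained coordinates, and these pull back to products. -/
theorem map_consTape : ((volume : Measure unitInterval).prod tapeLaw).map consTape = tapeLaw := by
  refine Measure.eq_infinitePi _ fun s t ht => ?_
  classical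
  have hpre : consTape ⁻¹' Set.pi s t = (if 0 ∈ s then t 0 else Set.univ) ×ˢ
      Set.pi (s.preimage Nat.succ Nat.succ_injective.injOn : Finset ℕ) (fun i => t (i + 1)) := by
    ext ⟨r, ω⟩
    simp only [Set.mem_preimage, Set.mem_pi, Set.mem_prod, Finset.coe_preimage, Finset.mem_coe]
    constructor
    · intro h
      refine ⟨?_, fun i hi => h (i + 1) hi⟩
      split_ifs with h0
      · exact h 0 h0
      · trivial
    · rintro ⟨h0, h⟩ i hi
      cases i with
      | zero => rw [if_pos hi] at h0; exact h0
      | succ i => exact h i hi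
  rw [Measure.map_apply measurable_consTape
    (MeasurableSet.pi s.countable_toSet fun i _ => ht i), hpre, Measure.prod_prod, tapeLaw,
    Measure.infinitePi_pi _ (fun i _ => ht _)]
  have himg : ∏ i ∈ s.preimage Nat.succ Nat.succ_injective.injOn, volume (t (i + 1)) =
      ∏ i ∈ s.erase 0, (volume : Measure unitInterval) (t i) := by
    refine Finset.prod_bij (fun i _ => i + 1) ?_ ?_ ?_ ?_
    · intro i hi
      simpa using hi
    · intro a _ b _ h
      simpa using h
    · intro b hb
      obtain ⟨hb0, hb⟩ := Finset.mem_erase.1 hb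
      exact ⟨b - 1, by simpa [Nat.succ_eq_add_one, Nat.sub_add_cancel (Nat.pos_of_ne_zero hb0)] using hb,
        Nat.sub_add_cancel (Nat.pos_of_ne_zero hb0)⟩
    · intro i _
      rfl
  rw [himg]
  split_ifs with h0
  · exact Finset.mul_prod_erase s (fun i => volume (t i)) h0
  · rw [measure_univ, one_mul, Finset.erase_eq_of_notMem h0]

/-- The tapes on which the choice `f` made with the first sample is followed by success. -/
def choiceSet (f : unitInterval → ℕ) (S : ℕ → Set Tape) : Set Tape :=
  {ω | (fun q => ω (q + 1)) ∈ S (f (ω 0))}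

variable {f : unitInterval → ℕ} {S : ℕ → Set Tape} {N : ℕ}

theorem measurableSet_choiceSet (hf : Measurable f) (hS : ∀ i, MeasurableSet (S i)) :
    MeasurableSet (choiceSet f S) := by
  have : choiceSet f S = ⋃ i, {ω : Tape | f (ω 0) = i} ∩ (fun ω q => ω (q + 1)) ⁻¹' S i := by
    ext ω
    simp [choiceSet]
  rw [this]
  refine MeasurableSet.iUnion fun i => MeasurableSet.inter ?_ ?_
  · exact (hf.comp (measurable_pi_apply 0)) (measurableSet_singleton i)
  · exact (measurable_pi_lambda _ fun q => measurable_pi_apply (q + 1)) (hS i)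

theorem tapeLaw_choiceSet (hf : Measurable f) (hN : ∀ r, f r < N) (hS : ∀ i, MeasurableSet (S i)) :
    tapeLaw.real (choiceSet f S) =
      ∑ i ∈ Finset.range N, volume.real (f ⁻¹' {i}) * tapeLaw.real (S i) := by
  have hpre : consTape ⁻¹' choiceSet f S = ⋃ i ∈ Finset.range N, (f ⁻¹' {i}) ×ˢ S i := by
    ext ⟨r, ω⟩
    simp only [Set.mem_preimage, choiceSet, Set.mem_ofPred_eq, Set.mem_iUnion, Set.mem_prod,
      Set.mem_singleton_iff, exists_prop, Finset.mem_range]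
    exact ⟨fun h => ⟨f r, hN r, rfl, h⟩, fun ⟨i, _, hi, h⟩ => by rw [← hi] at h; exact h⟩
  rw [← map_consTape, map_measureReal_apply measurable_consTape (measurableSet_choiceSet hf hS),
    hpre, measureReal_biUnion_finset, map_consTape]
  · exact Finset.sum_congr rfl fun i _ => measureReal_prod_prod _ _
  · intro i _ j _ hij
    refine Set.disjoint_left.2 ?_
    rintro ⟨r, ω⟩ ⟨h, -⟩ ⟨h', -⟩
    exact hij (h.symm.trans h')
  · exact fun i _ => (hf (measurableSet_singleton i)).prod (hS i)

theorem sum_choice_eq_one (hf : Measurable f) (hN : ∀ r, f r < N) :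
    ∑ i ∈ Finset.range N, volume.real (f ⁻¹' {i}) = 1 := by
  have h := tapeLaw_choiceSet hf hN (S := fun _ => Set.univ) fun _ => MeasurableSet.univ
  simpa [choiceSet] using h.symm

/-- If the law of the choice dominates `α` times the image of `u` under `σ`, then the success
probability is at least what is obtained by choosing according to `u` with probability `α`. -/
theorem le_tapeLaw_choiceSet (hf : Measurable f) (hN : ∀ r, f r < N)
    (hS : ∀ i, MeasurableSet (S i)) {ι : Type*} {O : Finset ι} {u : ι → ℝ} {σ : ι → ℕ} {α b : ℝ}
    (hu : ∀ o ∈ O, 0 ≤ u o) (hα : 0 ≤ α) (hσ : ∀ o ∈ O, σ o < N)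
    (hdom : ∀ i < N, α * ∑ o ∈ O with σ o = i, u o ≤ volume.real (f ⁻¹' {i}))
    (hb : ∀ i, b ≤ tapeLaw.real (S i)) {F : ι → ℝ}
    (hF : ∀ o ∈ O, F o ≤ tapeLaw.real (S (σ o)) - b) :
    b + α * ∑ o ∈ O, u o * F o ≤ tapeLaw.real (choiceSet f S) := by
  rw [tapeLaw_choiceSet hf hN hS]
  -- The choice probabilities sum to 1, so `b` splits off. The remaining factors `tapeLaw.real (S i)
  -- - b` are nonnegative, which lets the domination `hdom` be applied term by term even though `F`
  -- may take negative values.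
  have h1 : ∑ i ∈ Finset.range N, volume.real (f ⁻¹' {i}) * tapeLaw.real (S i) =
      b + ∑ i ∈ Finset.range N, volume.real (f ⁻¹' {i}) * (tapeLaw.real (S i) - b) := by
    simp only [mul_sub, Finset.sum_sub_distrib, ← Finset.sum_mul, sum_choice_eq_one hf hN]
    ring
  rw [h1]
  gcongr
  calc α * ∑ o ∈ O, u o * F o ≤ α * ∑ o ∈ O, u o * (tapeLaw.real (S (σ o)) - b) := by
        gcongr with o ho
        · exact hu o ho
        · exact hF o ho
    _ = ∑ i ∈ Finset.range N, (α * ∑ o ∈ O with σ o = i, u o) * (tapeLaw.real (S i) - b) := by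
        rw [← Finset.sum_fiberwise_of_maps_to (g := σ) (t := Finset.range N)
          (fun o ho => Finset.mem_range.2 (hσ o ho)), Finset.mul_sum]
        refine Finset.sum_congr rfl fun i _ => ?_
        rw [mul_assoc, Finset.sum_mul]
        congr 1
        refine Finset.sum_congr rfl fun o ho => ?_
        rw [(Finset.mem_filter.1 ho).2]
    _ ≤ _ := by
        refine Finset.sum_le_sum fun i hi => ?_
        exact mul_le_mul_of_nonneg_right (hdom i (Finset.mem_range.1 hi)) (sub_nonneg.2 (hb i))

/-! ### Sums of random choices -/

variable {E : Type*}

/-- The tapes on which `m` choices with values `x` are added to `y`, followed by success. -/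
def sumSet [AddCommMonoid E] (f : unitInterval → ℕ) (x : ℕ → E) (K : E → Set Tape) (m : ℕ) (y : E) : Set Tape :=
  {ω | (fun q => ω (m + q)) ∈ K (y + ∑ q ∈ Finset.range m, x (f (ω q)))}

theorem sumSet_zero [AddCommGroup E] (x : ℕ → E) (K : E → Set Tape) (y : E) : sumSet f x K 0 y = K y := by
  ext ω
  simp [sumSet]

/-- The first drawn value is absorbed into the starting point; this is why `y` is a parameter and
why the inductions on the number of draws let it vary. -/
theorem sumSet_succ [AddCommGroup E] (x : ℕ → E) (K : E → Set Tape) (m : ℕ) (y : E) :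
    sumSet f x K (m + 1) y = choiceSet f fun i => sumSet f x K m (y + x i) := by
  ext ω
  simp only [sumSet, choiceSet, Set.mem_ofPred_eq, Finset.sum_range_succ']
  rw [show (y + (∑ q ∈ Finset.range m, x (f (ω (q + 1))) + x (f (ω 0)))) =
    y + x (f (ω 0)) + ∑ q ∈ Finset.range m, x (f (ω (q + 1))) by abel]
  simp only [show ∀ q, m + 1 + q = m + q + 1 by intro q; ring]

theorem measurableSet_sumSet [AddCommGroup E] (hf : Measurable f) (x : ℕ → E) {K : E → Set Tape}
    (hK : ∀ y, MeasurableSet (K y)) (m : ℕ) (y : E) : MeasurableSet (sumSet f x K m y) := by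
  induction m generalizing y with
  | zero => rw [sumSet_zero]; exact hK y
  | succ m ih =>
    rw [sumSet_succ]
    exact measurableSet_choiceSet hf fun i => ih _

variable {ι : Type*} {O : Finset ι} {u : ι → ℝ} {σ : ι → ℕ} {α b c : ℝ} {x : ℕ → E}
  {K : E → Set Tape}

/-- A lower bound for the success probability by a functional of the sum that is compatible with
averaging. -/
theorem le_tapeLaw_sumSet [AddCommGroup E] (hf : Measurable f) (hN : ∀ r, f r < N)
    (hK : ∀ y, MeasurableSet (K y)) (hu : ∀ o ∈ O, 0 ≤ u o) (hα : 0 ≤ α)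
    (hσ : ∀ o ∈ O, σ o < N)
    (hdom : ∀ i < N, α * ∑ o ∈ O with σ o = i, u o ≤ volume.real (f ⁻¹' {i}))
    (hb : ∀ y, b ≤ tapeLaw.real (K y)) (F : ℕ → E → ℝ)
    (hF0 : ∀ y, b + F 0 y ≤ tapeLaw.real (K y))
    (hF : ∀ m y, F (m + 1) y ≤ ∑ o ∈ O, u o * F m (y + x (σ o))) (m : ℕ) (y : E) :
    b + α ^ m * F m y ≤ tapeLaw.real (sumSet f x K m y) := by
  -- The baseline survives further draws: this is the one-draw bound with zero gain.
  have hb' : ∀ m y, b ≤ tapeLaw.real (sumSet f x K m y) := by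
    intro m
    induction m with
    | zero => intro y; rw [sumSet_zero]; exact hb y
    | succ m ih =>
      intro y
      rw [sumSet_succ]
      have := le_tapeLaw_choiceSet (F := fun _ => 0) hf hN
        (fun i => measurableSet_sumSet hf x hK m (y + x i)) hu hα hσ hdom
        (fun i => ih _) (fun o _ => sub_nonneg.2 (ih _))
      simpa using this
  induction m generalizing y with
  | zero => simpa [sumSet_zero] using hF0 y
  | succ m ih =>
    rw [sumSet_succ]
    refine le_trans ?_ (le_tapeLaw_choiceSet (F := fun o => α ^ m * F m (y + x (σ o))) hf hN
      (fun i => measurableSet_sumSet hf x hK m (y + x i)) hu hα hσ hdom (fun i => hb' _ _)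
      (fun o _ => by linarith [ih (y + x (σ o))]))
    have h := mul_le_mul_of_nonneg_left (hF m y) (pow_nonneg hα (m + 1))
    rw [Finset.mul_sum] at h ⊢
    refine (add_le_add_iff_left b).2 (h.trans_eq (Finset.sum_congr rfl fun o _ => ?_))
    ring

/-- If the mean square distance of a sum of `M` independent choices with law `u` from `z` is at most
`B / 2`, and `K` is good near `z`, then success is likely. -/
theorem half_le_tapeLaw_sumSet [NormedAddCommGroup E] [InnerProductSpace ℝ E]
    (hf : Measurable f) (hN : ∀ r, f r < N)
    (hK : ∀ y, MeasurableSet (K y)) (hu : ∀ o ∈ O, 0 < u o) (hu1 : ∑ o ∈ O, u o = 1) (hα : 0 ≤ α)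
    (hσ : ∀ o ∈ O, σ o < N)
    (hdom : ∀ i < N, α * ∑ o ∈ O with σ o = i, u o ≤ volume.real (f ⁻¹' {i}))
    (hb : ∀ y, b ≤ tapeLaw.real (K y)) (hc : 0 ≤ c) {M : ℕ} {μ : E} {B : ℝ}
    (hgood : ∀ y, ‖y - (M : ℝ) • μ‖ ^ 2 ≤ B → b + c ≤ tapeLaw.real (K y))
    (hB : (M : ℝ) ^ 2 * ‖∑ o ∈ O, u o • x (σ o) - μ‖ ^ 2 +
      M * ∑ o ∈ O, u o * ‖x (σ o) - μ‖ ^ 2 ≤ B / 2) :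
    b + α ^ M * (c / 2) ≤ tapeLaw.real (sumSet f x K M 0) := by
  have hu' : ∀ o ∈ O, 0 ≤ u o := fun o ho => (hu o ho).le
  have hV : 0 ≤ ∑ o ∈ O, u o * ‖x (σ o) - μ‖ ^ 2 :=
    Finset.sum_nonneg fun o ho => mul_nonneg (hu' o ho) (sq_nonneg _)
  set ν := ∑ o ∈ O, u o • x (σ o)
  set V := ∑ o ∈ O, u o * ‖x (σ o) - μ‖ ^ 2
  have hB0 : 0 ≤ B := by
    have h1 : 0 ≤ (M : ℝ) ^ 2 * ‖ν - μ‖ ^ 2 := by positivity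
    have h2 : 0 ≤ (M : ℝ) * V := mul_nonneg (Nat.cast_nonneg M) hV
    linarith
  -- The second moment about the mean `ν` is at most the second moment `V` about `μ`.
  have hmean : ∀ a : E, ∑ o ∈ O, u o * ‖a + x (σ o)‖ ^ 2 ≤ ‖a + ν‖ ^ 2 + V := by
    intro a
    have e : ∀ o, u o * ‖a + x (σ o)‖ ^ 2 = u o * ‖a + μ‖ ^ 2 +
        2 * inner ℝ (a + μ) (u o • x (σ o) - u o • μ) + u o * ‖x (σ o) - μ‖ ^ 2 := by
      intro o
      rw [← smul_sub, inner_smul_right, show a + x (σ o) = (a + μ) + (x (σ o) - μ) by abel,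
        norm_add_sq_real]
      ring
    simp only [e, Finset.sum_add_distrib, ← Finset.mul_sum, ← Finset.sum_mul, hu1, ← inner_sum,
      Finset.sum_sub_distrib, ← Finset.sum_smul, one_smul]
    rw [show a + ν = (a + μ) + (ν - μ) by abel, norm_add_sq_real (a + μ) (ν - μ)]
    simp only [ν, V]
    nlinarith [sq_nonneg ‖∑ o ∈ O, u o • x (σ o) - μ‖]
  rcases hB0.lt_or_eq with hpos | hzero
  · have key := le_tapeLaw_sumSet (x := x) (b := b) hf hN hK hu' hα hσ hdom hb
      -- Chebyshev as a potential. With `m` draws from `u` still to come, `‖y - M μ + m ν‖ ^ 2 + m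
      -- V` bounds the expected squared distance of the final sum from `M μ`. The potential lies
      -- below the gain `c` times the indicator of the good ball, and `hmean` makes it compatible
      -- with averaging.
      (fun m y => c * (1 - (‖y - (M : ℝ) • μ + (m : ℝ) • ν‖ ^ 2 + m * V) / B)) ?_ ?_ M 0
    · refine le_trans ?_ key
      have : (‖0 - (M : ℝ) • μ + (M : ℝ) • ν‖ ^ 2 + M * V) / B ≤ 1 / 2 := by
        rw [div_le_iff₀ hpos, show (0 : E) - (M : ℝ) • μ + (M : ℝ) • ν = (M : ℝ) • (ν - μ) by
          rw [smul_sub]; abel, norm_smul, mul_pow, Real.norm_natCast]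
        linarith
      have h2 : c / 2 ≤ c * (1 - (‖0 - (M : ℝ) • μ + (M : ℝ) • ν‖ ^ 2 + M * V) / B) := by nlinarith
      have := mul_le_mul_of_nonneg_left h2 (pow_nonneg hα M)
      linarith
    · intro y
      simp only [Nat.cast_zero, zero_smul, add_zero, zero_mul]
      by_cases h : ‖y - (M : ℝ) • μ‖ ^ 2 ≤ B
      · have := hgood y h
        have h' : 0 ≤ ‖y - (M : ℝ) • μ‖ ^ 2 / B := by positivity
        nlinarith
      · have h' : 1 ≤ ‖y - (M : ℝ) • μ‖ ^ 2 / B := (one_le_div hpos).2 (not_le.1 h).le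
        have := hb y
        nlinarith
    · intro m y
      have e : ∀ o, u o * (c * (1 - (‖y + x (σ o) - (M : ℝ) • μ + (m : ℝ) • ν‖ ^ 2 + m * V) / B)) =
          u o * (c * (1 - m * V / B)) -
            c / B * (u o * ‖y - (M : ℝ) • μ + (m : ℝ) • ν + x (σ o)‖ ^ 2) := by
        intro o
        rw [show y + x (σ o) - (M : ℝ) • μ + (m : ℝ) • ν =
          y - (M : ℝ) • μ + (m : ℝ) • ν + x (σ o) by abel]
        ring
      simp only [e, Finset.sum_sub_distrib, ← Finset.mul_sum, ← Finset.sum_mul, hu1]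
      have h1 := mul_le_mul_of_nonneg_left (hmean (y - (M : ℝ) • μ + (m : ℝ) • ν))
        (div_nonneg hc hpos.le)
      rw [show y - (M : ℝ) • μ + (m : ℝ) • ν + ν = y - (M : ℝ) • μ + ((m + 1 : ℕ) : ℝ) • ν by
        push_cast; rw [add_smul, one_smul]; abel] at h1
      have e2 : c * (1 - (‖y - (M : ℝ) • μ + ((m + 1 : ℕ) : ℝ) • ν‖ ^ 2 + ((m + 1 : ℕ) : ℝ) * V) / B)
          = 1 * (c * (1 - m * V / B)) -
            c / B * (‖y - (M : ℝ) • μ + ((m + 1 : ℕ) : ℝ) • ν‖ ^ 2 + V) := by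
        push_cast; ring
      rw [e2]
      linarith
  · rcases Nat.eq_zero_or_pos M with rfl | hM
    · have := hgood 0 (by simp [← hzero])
      rw [sumSet_zero]
      simp only [pow_zero, one_mul]
      linarith
    have hM' : (0 : ℝ) < M := Nat.cast_pos.2 hM
    have hV0 : V = 0 := by
      have : (M : ℝ) * V ≤ 0 := by
        have := mul_nonneg (sq_nonneg (M : ℝ)) (sq_nonneg ‖ν - μ‖)
        linarith
      nlinarith
    -- For `B = 0` and `M > 0` division by `B` is useless, but `V = 0` and the strict positivity of
    -- `u` force every choice to equal `μ`. An indicator then serves as the potential.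
    have hx : ∀ o ∈ O, x (σ o) = μ := by
      intro o ho
      have := (Finset.sum_eq_zero_iff_of_nonneg
        (fun o ho => mul_nonneg (hu' o ho) (sq_nonneg ‖x (σ o) - μ‖))).1 hV0 o ho
      rcases mul_eq_zero.1 this with h | h
      · exact absurd h (hu o ho).ne'
      · exact sub_eq_zero.1 (norm_eq_zero.1 (pow_eq_zero_iff two_ne_zero |>.1 h))
    classical
    have key := le_tapeLaw_sumSet (x := x) (b := b) hf hN hK hu' hα hσ hdom hb
      (fun m y => if y + (m : ℝ) • μ = (M : ℝ) • μ then c else 0) ?_ ?_ M 0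
    · refine le_trans ?_ key
      simp only [zero_add, if_true]
      have := mul_le_mul_of_nonneg_left (show c / 2 ≤ c by linarith) (pow_nonneg hα M)
      linarith
    · intro y
      simp only [Nat.cast_zero, zero_smul, add_zero]
      split_ifs with h
      · exact hgood y (by simp [h, ← hzero])
      · linarith [hb y]
    · intro m y
      rw [Finset.sum_congr rfl fun o ho => by rw [hx o ho, show y + μ + (m : ℝ) • μ =
        y + ((m + 1 : ℕ) : ℝ) • μ by push_cast; rw [add_smul, one_smul]; abel], ← Finset.sum_mul,
        hu1, one_mul]

end

end RealRAM

/-! ## Clusters -/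

namespace RealRAM

noncomputable section

/-! ### Centroids and perturbations of a single cluster -/

section Cluster

variable {ι : Type*} {E : Type*} [NormedAddCommGroup E] [InnerProductSpace ℝ E]

/-- The cost of a cluster with respect to its centroid. -/
def clusterCost (p : ι → E) (w : ι → ℝ) (O : Finset ι) : ℝ :=
  ∑ i ∈ O, w i * ‖p i - O.centerMass w p‖ ^ 2

variable {p : ι → E} {w : ι → ℝ} {O : Finset ι}

theorem sum_pos_of_nonempty (hw : ∀ i, 0 < w i) (hO : O.Nonempty) : 0 < ∑ i ∈ O, w i :=
  Finset.sum_pos (fun i _ => hw i) hO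

theorem clusterCost_nonneg (hw : ∀ i, 0 < w i) : 0 ≤ clusterCost p w O :=
  Finset.sum_nonneg fun i _ => mul_nonneg (hw i).le (sq_nonneg _)

/-- The parallel axis identity: on expanding around the centroid, the cross term vanishes because
the weighted deviations sum to zero. -/
theorem sum_mul_norm_sub_sq (hw : ∀ i, 0 < w i) (c : E) :
    ∑ i ∈ O, w i * ‖p i - c‖ ^ 2 =
      clusterCost p w O + (∑ i ∈ O, w i) * ‖c - O.centerMass w p‖ ^ 2 := by
  rcases O.eq_empty_or_nonempty with rfl | hO
  · simp [clusterCost]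
  have hW := sum_pos_of_nonempty hw hO
  set μ := O.centerMass w p with hμ
  have e : ∀ i, w i * ‖p i - c‖ ^ 2 = w i * ‖p i - μ‖ ^ 2 -
      2 * inner ℝ (c - μ) (w i • p i - w i • μ) + w i * ‖c - μ‖ ^ 2 := by
    intro i
    rw [show p i - c = (p i - μ) - (c - μ) by abel, norm_sub_sq_real (p i - μ) (c - μ), ← smul_sub,
      inner_smul_right, real_inner_comm]
    ring
  have hz : ∑ i ∈ O, w i • p i - ∑ i ∈ O, w i • μ = 0 := by
    rw [← Finset.sum_smul, hμ, Finset.centerMass, smul_smul, mul_inv_cancel₀ hW.ne', one_smul,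
      sub_self]
  simp only [e, Finset.sum_add_distrib, Finset.sum_sub_distrib, ← Finset.mul_sum, ← Finset.sum_mul,
    ← inner_sum]
  rw [hz]
  simp [clusterCost, ← hμ]

theorem clusterCost_le (hw : ∀ i, 0 < w i) (c : E) :
    clusterCost p w O ≤ ∑ i ∈ O, w i * ‖p i - c‖ ^ 2 := by
  rw [sum_mul_norm_sub_sq hw]
  have := Finset.sum_nonneg fun i (_ : i ∈ O) => (hw i).le
  nlinarith [sq_nonneg ‖c - O.centerMass w p‖]

/-- If the points of a cluster that are very close to their nearest center `q i` are moved there,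
they are moved by little in comparison with the cost of the cluster. -/
theorem sum_moved_le (hw : ∀ i, 0 < w i) (hO : O.Nonempty) {q : ι → E} {D : ι → ℝ}
    (hDq : ∀ i, D i = ‖p i - q i‖ ^ 2) (hD : ∀ i, ∀ j, D i ≤ ‖p i - q j‖ ^ 2) {β Θ : ℝ}
    (hβ : 0 ≤ β) (hβ' : β ≤ 1 / 4) (hΘ : Θ ≤ β * ∑ i ∈ O, w i * D i) {x : ι → E}
    (hx : ∀ i, x i = p i ∨ x i = q i ∧ D i * ∑ i ∈ O, w i < Θ) :
    ∑ i ∈ O, w i * ‖x i - p i‖ ^ 2 ≤ 6 * β * clusterCost p w O := by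
  set W := ∑ i ∈ O, w i with hWdef
  have hW : 0 < W := sum_pos_of_nonempty hw hO
  set μ := O.centerMass w p
  set Δ := clusterCost p w O
  have hΔ : 0 ≤ Δ := clusterCost_nonneg hw
  have hpt : ∀ i, W * ‖x i - p i‖ ^ 2 ≤ 2 * β * Δ + 4 * β * (W * ‖p i - μ‖ ^ 2) := by
    intro i
    rcases hx i with h | ⟨h, hlt⟩
    · rw [h, sub_self, norm_zero]
      have : 0 ≤ W * ‖p i - μ‖ ^ 2 := by positivity
      have : 0 ≤ β * Δ := by positivity
      nlinarith
    -- Serving all of `O` by the single center `q i` is no cheaper than serving each point by its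
    -- nearest center. This bounds the threshold `Θ` through the distance from `q i` to the
    -- centroid.
    · have h1 : ∑ i' ∈ O, w i' * D i' ≤ Δ + W * ‖q i - μ‖ ^ 2 := by
        rw [← sum_mul_norm_sub_sq hw]
        exact Finset.sum_le_sum fun i' _ => mul_le_mul_of_nonneg_left (hD i' i) (hw i').le
      have h2 : ‖q i - μ‖ ^ 2 ≤ 2 * ‖p i - μ‖ ^ 2 + 2 * D i := by
        have h3 : ‖q i - μ‖ ≤ ‖p i - μ‖ + ‖p i - q i‖ := by
          rw [show q i - μ = (p i - μ) - (p i - q i) by abel]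
          exact norm_sub_le _ _
        rw [hDq]
        nlinarith [sq_nonneg (‖p i - μ‖ - ‖p i - q i‖), norm_nonneg (q i - μ)]
      rw [h, norm_sub_rev, ← hDq]
      have hD0 : 0 ≤ D i := by rw [hDq]; positivity
      have h4 : W * ‖q i - μ‖ ^ 2 ≤ W * (2 * ‖p i - μ‖ ^ 2 + 2 * D i) :=
        mul_le_mul_of_nonneg_left h2 hW.le
      have h5 : β * ∑ i' ∈ O, w i' * D i' ≤ β * (Δ + W * (2 * ‖p i - μ‖ ^ 2 + 2 * D i)) :=
        mul_le_mul_of_nonneg_left (h1.trans (by linarith)) hβ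
      -- The bounds give `W * D i ≤ β * (Δ + 2 * W * ‖p i - μ‖ ^ 2 + 2 * W * D i)`; as `β ≤ 1 / 4`,
      -- the last term is absorbed on the left at the price of a factor 2.
      have h6 : β * (W * D i) ≤ 1 / 4 * (W * D i) :=
        mul_le_mul_of_nonneg_right hβ' (by positivity)
      nlinarith
  have hsum : W * ∑ i ∈ O, w i * ‖x i - p i‖ ^ 2 ≤ W * (6 * β * Δ) := by
    calc W * ∑ i ∈ O, w i * ‖x i - p i‖ ^ 2 = ∑ i ∈ O, w i * (W * ‖x i - p i‖ ^ 2) := by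
          rw [Finset.mul_sum]
          exact Finset.sum_congr rfl fun i _ => by ring
      _ ≤ ∑ i ∈ O, w i * (2 * β * Δ + 4 * β * (W * ‖p i - μ‖ ^ 2)) :=
          Finset.sum_le_sum fun i _ => mul_le_mul_of_nonneg_left (hpt i) (hw i).le
      _ = (∑ i ∈ O, w i) * (2 * β * Δ) + 4 * β * W * ∑ i ∈ O, w i * ‖p i - μ‖ ^ 2 := by
          rw [Finset.sum_mul, Finset.mul_sum, ← Finset.sum_add_distrib]
          exact Finset.sum_congr rfl fun i _ => by ring
      _ = W * (6 * β * Δ) := by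
          rw [← hWdef, show ∑ i ∈ O, w i * ‖p i - μ‖ ^ 2 = Δ from rfl]
          ring
  exact le_of_mul_le_mul_left hsum hW

/-- The mean and the second moment of a slightly perturbed cluster. -/
theorem perturbed_moments (hw : ∀ i, 0 < w i) (hO : O.Nonempty) {x : ι → E} {γ : ℝ}
    (hx : ∑ i ∈ O, w i * ‖x i - p i‖ ^ 2 ≤ γ) :
    (∑ i ∈ O, w i) * ‖∑ i ∈ O, (w i / ∑ i ∈ O, w i) • x i - O.centerMass w p‖ ^ 2 ≤ γ ∧
      (∑ i ∈ O, w i) * ∑ i ∈ O, (w i / ∑ i ∈ O, w i) * ‖x i - O.centerMass w p‖ ^ 2 ≤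
        2 * clusterCost p w O + 2 * γ := by
  set W := ∑ i ∈ O, w i with hWdef
  have hW : 0 < W := sum_pos_of_nonempty hw hO
  set μ := O.centerMass w p with hμ
  constructor
  -- The shift of the centroid is the centroid of the displacements, so the parallel axis identity
  -- about `0` bounds it.
  · have h1 : ∑ i ∈ O, (w i / W) • x i - μ = O.centerMass w (fun i => x i - p i) := by
      simp [hμ, Finset.centerMass, ← hWdef, smul_sub, Finset.sum_sub_distrib, Finset.smul_sum,
        smul_smul, div_eq_inv_mul]
    have h2 := sum_mul_norm_sub_sq (p := fun i => x i - p i) (O := O) hw 0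
    rw [h1]
    simp only [sub_zero, zero_sub, norm_neg] at h2
    have := clusterCost_nonneg (p := fun i => x i - p i) (O := O) hw
    linarith
  · rw [Finset.mul_sum]
    calc ∑ i ∈ O, W * (w i / W * ‖x i - μ‖ ^ 2) ≤
          ∑ i ∈ O, (2 * (w i * ‖p i - μ‖ ^ 2) + 2 * (w i * ‖x i - p i‖ ^ 2)) := by
          refine Finset.sum_le_sum fun i _ => ?_
          have h3 : ‖x i - μ‖ ≤ ‖p i - μ‖ + ‖x i - p i‖ := by
            rw [show x i - μ = (p i - μ) + (x i - p i) by abel]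
            exact norm_add_le _ _
          have h4 : ‖x i - μ‖ ^ 2 ≤ 2 * ‖p i - μ‖ ^ 2 + 2 * ‖x i - p i‖ ^ 2 := by
            nlinarith [sq_nonneg (‖p i - μ‖ - ‖x i - p i‖), norm_nonneg (x i - μ)]
          have h5 := mul_le_mul_of_nonneg_left h4 (hw i).le
          rw [← mul_assoc, mul_div_cancel₀ _ hW.ne']
          linarith
      _ = 2 * clusterCost p w O + 2 * ∑ i ∈ O, w i * ‖x i - p i‖ ^ 2 := by
          rw [Finset.sum_add_distrib, ← Finset.mul_sum, ← Finset.mul_sum]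
          rfl
      _ ≤ _ := by linarith

end Cluster

/-! ### Optimal assignments and expensive clusters -/

variable {n d k : ℕ} {p : Fin n → EuclideanSpace ℝ (Fin d)} {w : Fin n → ℝ}
  {C : Fin k → EuclideanSpace ℝ (Fin d)}

/-- The points that `f` assigns to `j`. -/
def cluster (f : Fin n → Fin k) (j : Fin k) : Finset (Fin n) := {i | f i = j}

theorem sum_cluster (f : Fin n → Fin k) (g : Fin n → ℝ) :
    ∑ j, ∑ i ∈ cluster f j, g i = ∑ i, g i :=
  Finset.sum_fiberwise _ f g

theorem exists_infDist_eq (hk : 0 < k) (x : EuclideanSpace ℝ (Fin d)) :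
    ∃ l, Metric.infDist x (Set.range C) = dist x (C l) := by
  obtain ⟨_, ⟨l, rfl⟩, h⟩ := (Set.finite_range C).isCompact.exists_infDist_eq_dist
    ⟨C ⟨0, hk⟩, ⟨0, hk⟩, rfl⟩ x
  exact ⟨l, h⟩

/-- There is an optimal assignment of the points to clusters. -/
theorem exists_optimal_assignment (hk : 0 < k) (hw : ∀ i, 0 < w i) :
    ∃ f : Fin n → Fin k, ∀ C : Fin k → EuclideanSpace ℝ (Fin d),
      ∑ j, clusterCost p w (cluster f j) ≤ kMeansCost p w C := by
  have : Nonempty (Fin k) := ⟨⟨0, hk⟩⟩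
  -- There are finitely many assignments, so a minimum exists without any compactness argument for
  -- the centers.
  obtain ⟨f, hf⟩ := Finite.exists_min fun f : Fin n → Fin k => ∑ j, clusterCost p w (cluster f j)
  refine ⟨f, fun C => ?_⟩
  choose g hg using fun i => exists_infDist_eq (C := C) hk (p i)
  refine (hf g).trans ?_
  calc ∑ j, clusterCost p w (cluster g j) ≤ ∑ j, ∑ i ∈ cluster g j, w i * ‖p i - C j‖ ^ 2 :=
        Finset.sum_le_sum fun j _ => clusterCost_le hw _
    _ = ∑ j, ∑ i ∈ cluster g j, w i * Metric.infDist (p i) (Set.range C) ^ 2 := by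
        refine Finset.sum_congr rfl fun j _ => Finset.sum_congr rfl fun i hi => ?_
        rw [hg, dist_eq_norm, (Finset.mem_filter.1 hi).2]
    _ = kMeansCost p w C := sum_cluster g _

/-- One of the first `t` centers is good for the cluster `O`. -/
def Covered (p : Fin n → EuclideanSpace ℝ (Fin d)) (w : Fin n → ℝ) (ε : ℝ)
    (C : Fin k → EuclideanSpace ℝ (Fin d)) (t : ℕ) (O : Finset (Fin n)) : Prop :=
  O = ∅ ∨ ∃ l : Fin k, (l : ℕ) < t ∧
    (∑ i ∈ O, w i) * ‖C l - O.centerMass w p‖ ^ 2 ≤ ε / 2 * clusterCost p w O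

/-- If the current centers are not good, then some cluster that is not covered has a substantial
part of the cost. -/
theorem exists_expensive_cluster (hk : 0 < k) (hw : ∀ i, 0 < w i) {ε : ℝ} (hε : 0 < ε)
    (hε1 : ε < 1) {f : Fin n → Fin k} {t : ℕ}
    (hbad : (1 + ε) * ∑ j, clusterCost p w (cluster f j) < kMeansCost p w C) :
    ∃ j, ¬ Covered p w ε C t (cluster f j) ∧ ε / (4 * k) * kMeansCost p w C ≤
      ∑ i ∈ cluster f j, w i * Metric.infDist (p i) (Set.range C) ^ 2 := by
  by_contra! hcon
  have hk' : (0 : ℝ) < k := Nat.cast_pos.2 hk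
  set T := kMeansCost p w C with hT
  set Φ := ∑ j, clusterCost p w (cluster f j) with hΦ
  have hΦ0 : 0 ≤ Φ := Finset.sum_nonneg fun j _ => clusterCost_nonneg hw
  have hT0 : 0 < T := lt_of_le_of_lt (by positivity) hbad
  have hj : ∀ j, ∑ i ∈ cluster f j, w i * Metric.infDist (p i) (Set.range C) ^ 2 ≤
      (1 + ε / 2) * clusterCost p w (cluster f j) + ε / (4 * k) * T := by
    intro j
    have hc0 := clusterCost_nonneg (p := p) (O := cluster f j) hw
    by_cases hj : Covered p w ε C t (cluster f j)
    · have : 0 ≤ ε / (4 * k) * T := by positivity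
      rcases hj with h | ⟨l, -, h⟩
      · rw [h]; simpa [clusterCost] using this
      · have h1 : ∑ i ∈ cluster f j, w i * Metric.infDist (p i) (Set.range C) ^ 2 ≤
            ∑ i ∈ cluster f j, w i * ‖p i - C l‖ ^ 2 := by
          refine Finset.sum_le_sum fun i _ => mul_le_mul_of_nonneg_left ?_ (hw i).le
          rw [← dist_eq_norm]
          exact pow_le_pow_left₀ Metric.infDist_nonneg (Metric.infDist_le_dist_of_mem
            (Set.mem_range_self l)) 2
        rw [sum_mul_norm_sub_sq hw] at h1
        linarith
    · have := hcon j hj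
      nlinarith
  have hsum : T ≤ (1 + ε / 2) * Φ + ε / 4 * T := by
    calc T = ∑ j, ∑ i ∈ cluster f j, w i * Metric.infDist (p i) (Set.range C) ^ 2 :=
          (sum_cluster f _).symm
      _ ≤ ∑ j, ((1 + ε / 2) * clusterCost p w (cluster f j) + ε / (4 * k) * T) :=
          Finset.sum_le_sum fun j _ => hj j
      _ = (1 + ε / 2) * Φ + ε / 4 * T := by
          rw [Finset.sum_add_distrib, ← Finset.mul_sum, Finset.sum_const, Finset.card_univ,
            Fintype.card_fin, nsmul_eq_mul, ← hΦ]
          congr 1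
          field_simp
  -- Together with `(1 + ε) Φ < T` this is contradictory, because `(1 - ε / 4) (1 + ε) > 1 + ε / 2`
  -- for `0 < ε < 1`.
  nlinarith [mul_pos hε hT0, mul_nonneg hε.le hΦ0]

/-! ### The law of a drawn item -/

theorem mass_nonneg (hw : ∀ i, 0 < w i) (i : ℕ) : 0 ≤ mass p w C i := by
  unfold mass
  split_ifs
  · exact mul_nonneg (hw _).le (sq_nonneg _)
  · exact Finset.sum_nonneg fun i _ => mul_nonneg (hw i).le (sq_nonneg _)

theorem sum_mass : ∑ i ∈ Finset.range (n + k), mass p w C i = (k + 1) * kMeansCost p w C := by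
  rw [Finset.sum_range_add, sum_mass_eq_cost]
  simp [mass]
  ring

theorem pick_eq {m : ℕ → ℝ} (hm : ∀ i, 0 ≤ m i) {v : ℝ} {i N : ℕ} (hi : i < N)
    (h1 : ∑ i' ∈ Finset.range i, m i' ≤ v) (h2 : v < ∑ i' ∈ Finset.range (i + 1), m i') :
    pick m v N = i := by
  induction N with
  | zero => omega
  | succ N ih =>
    rw [pick]
    rcases Nat.lt_succ_iff_lt_or_eq.1 hi with h | rfl
    · rw [if_pos (h2.trans_le (Finset.sum_le_sum_of_subset_of_nonneg
        (Finset.range_mono h) fun _ _ _ => hm _)), ih h]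
    · rw [if_neg (not_lt.2 h1)]

theorem measurable_drawIndex : Measurable fun r : unitInterval => drawIndex p w C r := by
  unfold drawIndex
  induction n + k with
  | zero => exact measurable_const
  | succ N ih =>
    simp only [pick]
    exact Measurable.ite (measurableSet_lt (measurable_subtype_coe.mul_const _) measurable_const) ih
      measurable_const

/-- All samples between two consecutive normalised partial sums select the item `i`, and the length
of that interval is the left-hand side. Only a lower bound is needed for the domination. -/
theorem mass_div_le_volume (hw : ∀ i, 0 < w i) (hT : 0 < kMeansCost p w C) {i : ℕ}
    (hi : i < n + k) :
    mass p w C i / ((k + 1) * kMeansCost p w C) ≤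
      volume.real ((fun r : unitInterval => drawIndex p w C r) ⁻¹' {i}) := by
  set T := (k + 1) * kMeansCost p w C
  have hT' : 0 < T := by positivity
  set S : ℕ → ℝ := fun i => ∑ i' ∈ Finset.range i, mass p w C i'
  have hS0 : ∀ i, 0 ≤ S i := fun i => Finset.sum_nonneg fun _ _ => mass_nonneg hw _
  have hS1 : ∀ i ≤ n + k, S i ≤ T := by
    intro i hi
    exact (Finset.sum_le_sum_of_subset_of_nonneg (Finset.range_mono hi)
      fun _ _ _ => mass_nonneg hw _).trans_eq sum_mass
  have hmem : ∀ i ≤ n + k, S i / T ∈ unitInterval := fun i hi =>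
    ⟨div_nonneg (hS0 i) hT'.le, (div_le_one hT').2 (hS1 i hi)⟩
  have hsub : Set.Ico (⟨S i / T, hmem i hi.le⟩ : unitInterval) ⟨S (i + 1) / T, hmem (i + 1) hi⟩ ⊆
      (fun r : unitInterval => drawIndex p w C r) ⁻¹' {i} := by
    rintro r ⟨h1, h2⟩
    exact pick_eq (mass_nonneg hw) hi ((div_le_iff₀ hT').1 h1) ((lt_div_iff₀ hT').1 h2)
  refine le_trans (le_of_eq ?_) (measureReal_mono hsub)
  rw [Measure.real, unitInterval.volume_Ico, ENNReal.toReal_ofReal]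
  · simp only [S, Finset.sum_range_succ]
    ring
  · simp only [S, Finset.sum_range_succ, sub_nonneg]
    gcongr
    linarith [mass_nonneg (p := p) (C := C) hw i]

end

end RealRAM

/-! ## The success probability -/

namespace RealRAM

noncomputable section

variable {n d k : ℕ} {p : Fin n → EuclideanSpace ℝ (Fin d)} {w : Fin n → ℝ} {M : ℕ} {G : ℝ}

theorem Conf.keep_out_le (x : Conf d k) :
    kMeansCost p w (x.keep p w).out ≤ kMeansCost p w x.out ∧
      kMeansCost p w (x.keep p w).out ≤ kMeansCost p w x.cur := by
  unfold Conf.keep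
  dsimp only
  split_ifs with h
  · exact ⟨h.le, le_rfl⟩
  · exact ⟨le_rfl, not_lt.1 h⟩

/-- The tapes on which the algorithm, started in `x`, finds centers of cost at most `G`. -/
def succSet (p : Fin n → EuclideanSpace ℝ (Fin d)) (w : Fin n → ℝ) (M : ℕ) (G : ℝ) (N t : ℕ)
    (x : Conf d k) : Set Tape :=
  {ω | kMeansCost p w (Conf.iterate p w M N t x ω).out ≤ G}

/-- The recorded centers never get worse, so success cannot be undone by later steps. -/
theorem succSet_eq_univ {x : Conf d k} (hx : kMeansCost p w (x.keep p w).out ≤ G) (N t : ℕ) :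
    succSet p w M G N t x = Set.univ := by
  refine Set.eq_univ_of_forall fun ω => ?_
  induction N generalizing x t ω with
  | zero => exact hx
  | succ N ih =>
    have h : kMeansCost p w ((x.step p w M t ω).keep p w).out ≤ G :=
      (Conf.keep_out_le (x.step p w M t ω)).1.trans hx
    have := ih h (if t + 1 < k then t + 1 else 0) fun q => ω (M + q)
    simpa only [succSet, Conf.iterate, Set.mem_ofPred_eq] using this

/-- The configuration after resampling the center number `t`, if the drawn items add up to `y`. -/
def Conf.next (p : Fin n → EuclideanSpace ℝ (Fin d)) (w : Fin n → ℝ) (M t : ℕ) (x : Conf d k)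
    (y : EuclideanSpace ℝ (Fin d)) : Conf d k :=
  ⟨setCenter x.cur t ((M : ℝ)⁻¹ • y), (x.keep p w).out⟩

theorem succSet_succ (N t : ℕ) (x : Conf d k) :
    succSet p w M G (N + 1) t x =
      sumSet (fun r => drawIndex p w x.cur r) (items p x.cur)
        (fun y => succSet p w M G N (if t + 1 < k then t + 1 else 0) (x.next p w M t y)) M 0 := by
  ext ω
  simp only [succSet, sumSet, zero_add]
  rfl

theorem measurableSet_succSet (N t : ℕ) (x : Conf d k) :
    MeasurableSet (succSet p w M G N t x) := by
  induction N generalizing t x with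
  | zero =>
    by_cases h : kMeansCost p w (x.keep p w).out ≤ G
    · rw [succSet_eq_univ h]; exact MeasurableSet.univ
    · convert MeasurableSet.empty
      exact Set.eq_empty_of_forall_notMem fun ω hω => h hω
  | succ N ih =>
    rw [succSet_succ]
    exact measurableSet_sumSet measurable_drawIndex _ (fun y => ih _ _) _ _

theorem le_succSet_succ (hn : 0 < n) {N t : ℕ} {b : ℝ}
    (hb : ∀ x : Conf d k, b ≤ tapeLaw.real (succSet p w M G N (if t + 1 < k then t + 1 else 0) x))
    (x : Conf d k) : b ≤ tapeLaw.real (succSet p w M G (N + 1) t x) := by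
  rw [succSet_succ]
  -- An empty index set with `α = 0` asks for no gain, leaving only the baseline `b`.
  have := le_tapeLaw_sumSet (O := (∅ : Finset ℕ)) (u := fun _ => 0) (σ := id) (α := 0) (b := b)
    (x := items p x.cur) measurable_drawIndex (fun r => drawIndex_lt (p := p) (w := w) (C := x.cur) hn r)
    (fun y => measurableSet_succSet (p := p) (w := w) (M := M) (G := G) N
      (if t + 1 < k then t + 1 else 0) (x.next p w M t y)) (by simp) le_rfl (by simp)
    (by simp) (fun y => hb _) (fun _ _ => 0) (fun y => by simpa using hb _) (by simp) M 0
  simpa using this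

/-- Here `γ` is the displacement bound `6 β Δ`. The squared bias and the variance term together are
at most `5 M Δ`, whereas `M ε ≥ 100` makes the right-hand side at least `25 M Δ`. -/
theorem resample_bound {M ε Δ γ : ℝ} (hε : 0 < ε) (hM : 100 ≤ M * ε) (hM1 : 1 ≤ M) (hΔ : 0 ≤ Δ)
    (hγ : γ = 6 * (4 / (ε * M ^ 2)) * Δ) :
    M ^ 2 * γ + M * (2 * Δ + 2 * γ) ≤ M ^ 2 * (ε / 2 * Δ) / 2 := by
  have hM0 : 0 < M := by linarith
  have hγ1 : M ^ 2 * γ ≤ M * Δ := by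
    have : M ^ 2 * γ = 24 * Δ / ε := by rw [hγ]; field_simp; ring
    rw [this, div_le_iff₀ hε]
    nlinarith
  have hγ0 : 0 ≤ γ := by rw [hγ]; positivity
  have hγ2 : M * γ ≤ M * Δ := by nlinarith [mul_nonneg hM0.le hγ0]
  have h3 : 100 * (M * Δ) ≤ M * ε * (M * Δ) := mul_le_mul_of_nonneg_right hM (by positivity)
  nlinarith [mul_nonneg hM0.le hΔ]

/-- From centers that are not good yet, some cluster that is not covered is covered after
resampling with substantial probability. -/
theorem exists_cluster_of_resample (hn : 0 < n) (hk : 0 < k) (hw : ∀ i, 0 < w i) {ε : ℝ}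
    (hε : 0 < ε) (hε1 : ε < 1) (hM : 100 ≤ M * ε) {f : Fin n → Fin k} {x : Conf d k}
    (hbad : (1 + ε) * ∑ j, clusterCost p w (cluster f j) < kMeansCost p w x.cur) (N t : ℕ) :
    ∃ j, ¬ Covered p w ε x.cur t (cluster f j) ∧ ∀ b c : ℝ, 0 ≤ c →
      (∀ x : Conf d k, b ≤ tapeLaw.real (succSet p w M G N (if t + 1 < k then t + 1 else 0) x)) →
      (∀ y : EuclideanSpace ℝ (Fin d), (∑ i ∈ cluster f j, w i) *
        ‖y - (cluster f j).centerMass w p‖ ^ 2 ≤ ε / 2 * clusterCost p w (cluster f j) →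
        b + c ≤ tapeLaw.real (succSet p w M G N (if t + 1 < k then t + 1 else 0)
          ⟨setCenter x.cur t y, (x.keep p w).out⟩)) →
      b + (1 / ((M : ℝ) ^ 2 * (k * (k + 1)))) ^ M * (c / 2) ≤
        tapeLaw.real (succSet p w M G (N + 1) t x) := by
  obtain ⟨j, hj, hcost⟩ := exists_expensive_cluster (t := t) hk hw hε hε1 hbad
  refine ⟨j, hj, fun b c hc hb hgood => ?_⟩
  set O := cluster f j
  have hO : O.Nonempty := Finset.nonempty_iff_ne_empty.2 fun h => hj (.inl h)
  set W := ∑ i ∈ O, w i with hWdef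
  have hW : 0 < W := sum_pos_of_nonempty hw hO
  set T := kMeansCost p w x.cur
  have hT : 0 < T := lt_of_le_of_lt (mul_nonneg (by linarith)
    (Finset.sum_nonneg fun j _ => clusterCost_nonneg hw)) hbad
  have hk0 : (0 : ℝ) < k := Nat.cast_pos.2 hk
  have hM0 : (0 : ℝ) < M := by
    by_contra! h
    nlinarith
  have hM1 : (1 : ℝ) ≤ M := Nat.one_le_cast.2 (Nat.cast_pos.1 hM0)
  have hM100 : (100 : ℝ) ≤ M := by nlinarith
  set α : ℝ := 1 / ((M : ℝ) ^ 2 * (k * (k + 1))) with hα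
  have hα0 : 0 < α := by positivity
  set D : Fin n → ℝ := fun i => Metric.infDist (p i) (Set.range x.cur) ^ 2 with hDdef
  choose g hg using fun i => exists_infDist_eq (C := x.cur) hk (p i)
  -- `D i * W ≥ Θ` is exactly the condition for point `i` to be drawn with probability at least `α *
  -- (w i / W)`. Then `β` is chosen so that `β * (ε / (4 k) * T) = Θ`.
  set Θ := α * ((k + 1) * T)
  set β : ℝ := 4 / (ε * M ^ 2) with hβ
  have hβ0 : 0 ≤ β := by positivity
  have hβ1 : β ≤ 1 / 4 := by
    rw [hβ, div_le_iff₀ (by positivity)]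
    nlinarith
  have hΘ : Θ ≤ β * ∑ i ∈ O, w i * D i := by
    refine le_trans (le_of_eq ?_) (mul_le_mul_of_nonneg_left hcost hβ0)
    simp only [Θ, hα, hβ]
    field_simp
  classical
  -- Points too rare to be sampled are represented by the item of their nearest current center; all
  -- others represent themselves.
  set σ : Fin n → ℕ := fun i => if D i * W < Θ then n + g i else i with hσdef
  have hitem : ∀ i, items p x.cur (σ i) = p i ∨
      items p x.cur (σ i) = x.cur (g i) ∧ D i * W < Θ := by
    intro i
    by_cases h : D i * W < Θ
    · exact .inr ⟨by simp [hσdef, h, items], h⟩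
    · exact .inl (by simp [hσdef, h, items])
  have hmoved := sum_moved_le hw hO (q := fun i => x.cur (g i)) (D := D)
    (fun i => by rw [hDdef, ← dist_eq_norm, ← hg])
    (fun i i' => by
      rw [← dist_eq_norm]
      exact pow_le_pow_left₀ Metric.infDist_nonneg (Metric.infDist_le_dist_of_mem
        (Set.mem_range_self _)) 2) hβ0 hβ1 hΘ hitem
  obtain ⟨hmean, hvar⟩ := perturbed_moments hw hO hmoved
  set μ := O.centerMass w p
  set Δ := clusterCost p w O
  have hΔ : 0 ≤ Δ := clusterCost_nonneg hw
  rw [succSet_succ]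
  refine half_le_tapeLaw_sumSet (O := O) (u := fun i => w i / W) (σ := σ) (μ := μ)
    (B := (M : ℝ) ^ 2 * (ε / 2 * Δ) / W) measurable_drawIndex
    (fun r => drawIndex_lt hn r) (fun y => measurableSet_succSet _ _ _)
    (fun i _ => div_pos (hw i) hW) ?_ hα0.le ?_ ?_ (fun y => hb _) hc ?_ ?_
  · rw [← Finset.sum_div, div_self hW.ne']
  · intro i _
    simp only [hσdef]
    split_ifs <;> omega
  · intro i hi
    refine le_trans ?_ (mass_div_le_volume hw hT hi)
    by_cases hin : i < n
    · have hsub : ∀ o ∈ O.filter (fun o => σ o = i), o = ⟨i, hin⟩ ∧ Θ ≤ D ⟨i, hin⟩ * W := by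
        intro o ho
        have h := (Finset.mem_filter.1 ho).2
        simp only [hσdef] at h
        split_ifs at h with h'
        · omega
        · subst h
          exact ⟨rfl, not_lt.1 h'⟩
      rcases (O.filter (fun o => σ o = i)).eq_empty_or_nonempty with h | ⟨o, ho⟩
      · rw [h, Finset.sum_empty, mul_zero]
        exact div_nonneg (mass_nonneg hw _) (by positivity)
      · have hle : ∑ o ∈ O.filter (fun o => σ o = i), w o / W ≤ w ⟨i, hin⟩ / W := by
          calc _ ≤ ∑ o ∈ {⟨i, hin⟩}, w o / W :=
                Finset.sum_le_sum_of_subset_of_nonneg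
                  (fun o ho => Finset.mem_singleton.2 (hsub o ho).1)
                  fun o _ _ => (div_pos (hw o) hW).le
            _ = _ := Finset.sum_singleton _ _
        refine (mul_le_mul_of_nonneg_left hle hα0.le).trans ?_
        have hm : mass p w x.cur i = w ⟨i, hin⟩ * D ⟨i, hin⟩ := by simp [mass, hin, hDdef]
        rw [hm, ← mul_div_assoc, div_le_div_iff₀ hW (by positivity)]
        have := mul_le_mul_of_nonneg_left (hsub o ho).2 (hw ⟨i, hin⟩).le
        simp only [Θ] at this
        nlinarith
    -- Many points may be moved to one center, but their total law is at most 1, and a center is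
    -- drawn with probability `1 / (k + 1) ≥ α`.
    · have hle : ∑ o ∈ O.filter (fun o => σ o = i), w o / W ≤ 1 := by
        calc _ ≤ ∑ o ∈ O, w o / W := Finset.sum_le_sum_of_subset_of_nonneg
              (Finset.filter_subset _ _) fun o _ _ => (div_pos (hw o) hW).le
          _ = 1 := by rw [← Finset.sum_div, div_self hW.ne']
      have hm : mass p w x.cur i = T := by simp [mass, hin, T]
      rw [hm]
      refine (mul_le_mul_of_nonneg_left hle hα0.le).trans ?_
      rw [mul_one, hα, div_le_div_iff₀ (by positivity) (by positivity)]
      have h1 : (1 : ℝ) ≤ M ^ 2 * k := one_le_mul_of_one_le_of_one_le (one_le_pow₀ hM1)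
        (Nat.one_le_cast.2 hk)
      nlinarith [mul_le_mul_of_nonneg_right h1 (show 0 ≤ (k + 1) * T by positivity)]
  · intro y hy
    refine hgood _ ?_
    rw [show y - (M : ℝ) • μ = (M : ℝ) • ((M : ℝ)⁻¹ • y - μ) by
      rw [smul_sub, smul_smul, mul_inv_cancel₀ hM0.ne', one_smul], norm_smul, mul_pow,
      Real.norm_natCast, mul_div_assoc] at hy
    have := le_of_mul_le_mul_left hy (by positivity)
    rwa [le_div_iff₀ hW, mul_comm] at this
  · have key := resample_bound hε hM hM1 hΔ rfl
    rw [div_right_comm, le_div_iff₀ hW]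
    refine le_trans ?_ key
    have h1 := mul_le_mul_of_nonneg_left hmean (sq_nonneg (M : ℝ))
    have h2 := mul_le_mul_of_nonneg_left hvar hM0.le
    rw [← hWdef] at h1 h2
    rw [add_mul]
    calc _ = (M : ℝ) ^ 2 * (W * ‖∑ i ∈ O, (w i / W) • items p x.cur (σ i) - μ‖ ^ 2) +
          M * (W * ∑ i ∈ O, w i / W * ‖items p x.cur (σ i) - μ‖ ^ 2) := by ring
      _ ≤ _ := add_le_add h1 h2

theorem Covered.setCenter {ε : ℝ} {C : Fin k → EuclideanSpace ℝ (Fin d)} {t : ℕ}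
    {O : Finset (Fin n)} (h : Covered p w ε C t O) (y : EuclideanSpace ℝ (Fin d)) :
    Covered p w ε (setCenter C t y) (t + 1) O := by
  rcases h with h | ⟨l, hl, h⟩
  · exact .inl h
  · refine .inr ⟨l, by omega, ?_⟩
    rwa [RealRAM.setCenter, if_neg hl.ne]

/-- The success probability of the remaining `m` steps of a trial, if at most `m` clusters are
not covered yet. -/
theorem le_succSet_trial (hn : 0 < n) (hk : 0 < k) (hw : ∀ i, 0 < w i) {ε : ℝ}
    (hε : 0 < ε) (hε1 : ε < 1) (hM : 100 ≤ M * ε) {f : Fin n → Fin k} {N : ℕ} {b : ℝ} (hb1 : b ≤ 1)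
    (hb : ∀ x : Conf d k, b ≤ tapeLaw.real
      (succSet p w M ((1 + ε) * ∑ j, clusterCost p w (cluster f j)) N 0 x)) {m : ℕ} (hm : m ≤ k)
    {x : Conf d k} {S : Finset (Fin k)} (hS : S.card ≤ m)
    (hcov : ∀ j ∉ S, Covered p w ε x.cur (k - m) (cluster f j)) :
    b + (1 - b) * ((1 / ((M : ℝ) ^ 2 * (k * (k + 1)))) ^ M / 2) ^ m ≤
      tapeLaw.real (succSet p w M ((1 + ε) * ∑ j, clusterCost p w (cluster f j)) (m + N)
        (if m = 0 then 0 else k - m) x) := by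
  set G := (1 + ε) * ∑ j, clusterCost p w (cluster f j) with hG
  set η : ℝ := (1 / ((M : ℝ) ^ 2 * (k * (k + 1)))) ^ M / 2 with hη
  have hM1 : (1 : ℝ) ≤ M := by
    have : M ≠ 0 := by rintro rfl; norm_num at hM
    exact Nat.one_le_cast.2 (Nat.pos_of_ne_zero this)
  have hk1 : (1 : ℝ) ≤ k := Nat.one_le_cast.2 hk
  have hη0 : 0 ≤ η := by positivity
  have hη1 : η ≤ 1 := by
    have : (1 / ((M : ℝ) ^ 2 * (k * (k + 1)))) ^ M ≤ 1 := by
      refine pow_le_one₀ (by positivity) ((div_le_one (by positivity)).2 ?_)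
      exact one_le_mul_of_one_le_of_one_le (one_le_pow₀ hM1) (by nlinarith)
    rw [hη]
    linarith
  have hlow : ∀ m ≤ k, ∀ x : Conf d k,
      b ≤ tapeLaw.real (succSet p w M G (m + N) (if m = 0 then 0 else k - m) x) := by
    intro m
    induction m with
    | zero => intro _ x; simpa using hb x
    | succ m ih =>
      intro hm x
      rw [show m + 1 + N = (m + N) + 1 by ring]
      refine le_succSet_succ hn (fun x => ?_) x
      -- With `m` steps left the next center has number `k - m`; for `m = 0` the counter has wrapped
      -- around to 0, ready for the next trial.
      have e : (if (if m + 1 = 0 then 0 else k - (m + 1)) + 1 < k then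
          (if m + 1 = 0 then 0 else k - (m + 1)) + 1 else 0) = if m = 0 then 0 else k - m := by
        rw [if_neg (Nat.succ_ne_zero m)]
        split_ifs <;> omega
      rw [e]
      exact ih (by omega) x
  induction m generalizing x S with
  | zero =>
    rw [succSet_eq_univ]
    · simp
    · refine (Conf.keep_out_le x).2.trans (not_lt.1 fun h => ?_)
      obtain ⟨j, hj, -⟩ := exists_expensive_cluster (t := k) hk hw hε hε1 h
      exact hj (hcov j (by simp [Finset.card_eq_zero.1 (Nat.le_zero.1 hS)]))
  | succ m ih =>
    -- If the current centers are already good, the next comparison records them. Otherwise one more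
    -- cluster can be covered.
    by_cases hgood : kMeansCost p w x.cur ≤ G
    · rw [succSet_eq_univ ((Conf.keep_out_le x).2.trans hgood), probReal_univ]
      have := pow_le_one₀ hη0 hη1 (n := m + 1)
      nlinarith
    rw [if_neg (Nat.succ_ne_zero m), show m + 1 + N = (m + N) + 1 by ring]
    have e : (if k - (m + 1) + 1 < k then k - (m + 1) + 1 else 0) = if m = 0 then 0 else k - m := by
      split_ifs <;> omega
    obtain ⟨j, hj, hstep⟩ := exists_cluster_of_resample (G := G) hn hk hw hε hε1 hM
      (not_le.1 hgood) (m + N) (k - (m + 1))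
    rw [e] at hstep
    refine le_trans (le_of_eq ?_) (hstep b ((1 - b) * η ^ m) (mul_nonneg (by linarith)
      (pow_nonneg hη0 m)) (hlow m (by omega)) fun y hy => ?_)
    · rw [pow_succ, hη]; ring
    · refine ih (by omega) (S := S.erase j) ?_ ?_
      · rw [Finset.card_erase_of_mem (by_contra fun h => hj (hcov j h))]
        omega
      · intro j' hj'
        rw [show k - m = k - (m + 1) + 1 by omega]
        by_cases hjj : j' = j
        · refine .inr ⟨⟨k - (m + 1), by omega⟩, by simp, ?_⟩
          simpa [setCenter, hjj] using hy
        -- Earlier covering centers have numbers below the resampled one, so they are not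
        -- overwritten.
        · exact (hcov j' fun h => hj' (Finset.mem_erase.2 ⟨hjj, h⟩)).setCenter y

/-- The success probability of `N` trials. -/
theorem le_succSet_trials (hn : 0 < n) (hk : 0 < k) (hw : ∀ i, 0 < w i) {ε : ℝ}
    (hε : 0 < ε) (hε1 : ε < 1) (hM : 100 ≤ M * ε) (f : Fin n → Fin k) {q : ℝ}
    (hq1 : q ≤ 1) (hq : q ≤ ((1 / ((M : ℝ) ^ 2 * (k * (k + 1)))) ^ M / 2) ^ k) (N : ℕ)
    (x : Conf d k) :
    1 - (1 - q) ^ N ≤ tapeLaw.real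
      (succSet p w M ((1 + ε) * ∑ j, clusterCost p w (cluster f j)) (N * k) 0 x) := by
  induction N generalizing x with
  | zero => simp
  | succ N ih =>
    have hpow : 0 ≤ (1 - q) ^ N := pow_nonneg (by linarith) N
    -- A new trial starts with no cluster assumed covered, and the bound for the `N` later trials is
    -- the baseline `b`; thus the failure bound is multiplied by `1 - q`.
    have := le_succSet_trial (m := k) (S := Finset.univ) (x := x) hn hk hw hε hε1 hM
      (show 1 - (1 - q) ^ N ≤ 1 by linarith) ih le_rfl (by simp) (by simp)
    rw [if_neg hk.ne', Nat.sub_self, show k + N * k = (N + 1) * k by ring] at this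
    refine le_trans ?_ this
    rw [pow_succ]
    nlinarith

theorem half_le_succSet (hn : 0 < n) (hk : 0 < k) (hw : ∀ i, 0 < w i) {ε : ℝ}
    (hε : 0 < ε) (hε1 : ε < 1) (hM : 100 ≤ M * ε) (f : Fin n → Fin k) (x : Conf d k) :
    1 / 2 ≤ tapeLaw.real (succSet p w M ((1 + ε) * ∑ j, clusterCost p w (cluster f j))
      (trials k M * k) 0 x) := by
  have hM0 : 0 < M := Nat.pos_of_ne_zero (by rintro rfl; norm_num at hM)
  have hM1 : (1 : ℝ) ≤ M := Nat.one_le_cast.2 hM0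
  have hk1 : (1 : ℝ) ≤ k := Nat.one_le_cast.2 hk
  set R := trials k M with hR
  have hR1 : (1 : ℝ) ≤ R := by
    refine Nat.one_le_cast.2 (Nat.one_le_pow _ _ ?_)
    positivity
  have hR0 : (0 : ℝ) < R := by linarith
  refine le_trans ?_ (le_succSet_trials (q := 1 / R) hn hk hw hε hε1 hM f
    ((div_le_one hR0).2 hR1) ?_ R x)
  · have h1 : (1 - 1 / (R : ℝ)) ^ R ≤ Real.exp (-1) := by
      calc (1 - 1 / (R : ℝ)) ^ R ≤ Real.exp (-(1 / R)) ^ R := by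
            refine pow_le_pow_left₀ (sub_nonneg.2 ((div_le_one hR0).2 hR1)) ?_ R
            linarith [Real.add_one_le_exp (-(1 / (R : ℝ)))]
        _ = Real.exp (-1) := by
            rw [← Real.exp_nat_mul]
            congr 1
            field_simp
    have h2 : Real.exp (-1) ≤ 1 / 2 := by
      rw [Real.exp_neg, ← one_div]
      exact one_div_le_one_div_of_le two_pos (by linarith [Real.add_one_le_exp (1 : ℝ)])
    linarith
  · set α : ℝ := 1 / ((M : ℝ) ^ 2 * (k * (k + 1))) with hα
    have hα0 : 0 ≤ α := by positivity
    have e : 1 / (R : ℝ) = ((α / 2) ^ M) ^ k := by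
      rw [← pow_mul, hR, trials, hα]
      push_cast
      rw [← one_div_pow]
      congr 1
      field_simp
    rw [e]
    refine pow_le_pow_left₀ (by positivity) ?_ k
    rw [div_pow]
    refine div_le_div_of_nonneg_left (by positivity) two_pos ?_
    -- `(α / 2) ^ M ≤ α ^ M / 2` because `2 ≤ 2 ^ M`. This is why the base of `trials` is `2 / α`.
    exact le_self_pow₀ one_le_two hM0.ne'

end

end RealRAM

/-! ## The main theorem -/

namespace RealRAM

theorem time_bound {n d k : ℕ} (hn : 1 ≤ n) (hd : 1 ≤ d) (hk : 1 ≤ k) {ε : ℝ} (hε : 0 < ε)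
    (hε1 : ε < 1) :
    ((3000 * ((trials k ⌈100 / ε⌉₊ * k + 1) *
      ((n + 1) * (k + 1) * (d + 1) * (⌈100 / ε⌉₊ + 1))) : ℕ) : ℝ) ≤
      3000 * ((n : ℝ) * d) *
        2 ^ (3000 * ((k : ℝ) ^ 2 / ε) * Real.log (2 + (k : ℝ) ^ 2 / ε) ^ 1) := by
  set M := ⌈100 / ε⌉₊
  set x : ℝ := (k : ℝ) ^ 2 / ε with hx
  set y : ℝ := 2 + x with hy
  have hn1 : (1 : ℝ) ≤ n := Nat.one_le_cast.2 hn
  have hd1 : (1 : ℝ) ≤ d := Nat.one_le_cast.2 hd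
  have hk1 : (1 : ℝ) ≤ k := Nat.one_le_cast.2 hk
  have hxk : (k : ℝ) / ε ≤ x := by rw [hx]; gcongr; nlinarith
  have hkε : (k : ℝ) ≤ k / ε := by rw [le_div_iff₀ hε]; nlinarith
  have h1ε : 1 / ε ≤ k / ε := by gcongr
  have hone : 1 ≤ 1 / ε := by rw [le_div_iff₀ hε]; linarith
  have hx1 : 1 ≤ x := by linarith
  have hy3 : 3 ≤ y := by linarith
  have hM : (M : ℝ) ≤ 101 / ε := by
    have h1 := (Nat.ceil_lt_add_one (show 0 ≤ 100 / ε by positivity)).le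
    have h2 : 101 / ε = 100 / ε + 1 / ε := by ring
    linarith
  have hMx : (M : ℝ) ≤ 101 * x := by
    have : 101 / ε = 101 * (1 / ε) := by ring
    linarith
  have hMk : (M : ℝ) * k ≤ 101 * x := by
    calc (M : ℝ) * k ≤ 101 / ε * k := by gcongr
      _ = 101 * (k / ε) := by ring
      _ ≤ _ := by linarith
  have hkx : (k : ℝ) ≤ x := hkε.trans hxk
  -- Since `y ≥ 3`, numerical constants are absorbed into powers of `y`; here `4 * 101 ^ 2 ≤ 3 ^
  -- 10`.
  have hbase : ((2 * (M * M) * (k * (k + 1)) : ℕ) : ℝ) ≤ y ^ 14 := by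
    push_cast
    calc 2 * ((M : ℝ) * M) * (k * (k + 1)) ≤ 2 * ((101 * x) * (101 * x)) * (x * (x + x)) := by
          gcongr
      _ = 40804 * x ^ 4 := by ring
      _ ≤ 3 ^ 10 * x ^ 4 := by gcongr; norm_num
      _ ≤ y ^ 10 * y ^ 4 := by gcongr; linarith
      _ = y ^ 14 := by ring
  have hR : (trials k M : ℝ) ≤ y ^ (1414 * x) := by
    rw [trials, Nat.cast_pow]
    calc ((2 * (M * M) * (k * (k + 1)) : ℕ) : ℝ) ^ (M * k) ≤ (y ^ 14) ^ (M * k) :=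
          pow_le_pow_left₀ (Nat.cast_nonneg _) hbase _
      _ = y ^ ((14 : ℝ) * (M * k)) := by
          rw [← pow_mul, ← Real.rpow_natCast]
          push_cast
          rfl
      _ ≤ y ^ (1414 * x) := Real.rpow_le_rpow_of_exponent_le (by linarith) (by linarith)
  have hR1 : (1 : ℝ) ≤ y ^ (1414 * x) := Real.one_le_rpow (by linarith) (by positivity)
  -- `1632 = 2 * 2 * 2 * 2 * 102` collects the constants lost when each `+ 1` in the step count is
  -- absorbed.
  have hpoly : 1632 * x ^ 3 ≤ y ^ (10 : ℝ) := by
    rw [show (10 : ℝ) = ((10 : ℕ) : ℝ) by norm_num, Real.rpow_natCast]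
    calc 1632 * x ^ 3 ≤ 3 ^ 7 * x ^ 3 := by gcongr; norm_num
      _ ≤ y ^ 7 * y ^ 3 := by gcongr; linarith
      _ = y ^ 10 := by ring
  have hexp : y ^ (10 : ℝ) * y ^ (1414 * x) ≤ 2 ^ (3000 * x * Real.log y ^ 1) := by
    rw [← Real.rpow_add (by linarith), Real.rpow_def_of_pos (by linarith : 0 < y),
      Real.rpow_def_of_pos two_pos]
    refine Real.exp_le_exp.2 ?_
    have hlog : 0 ≤ Real.log y := Real.log_nonneg (by linarith)
    have h2 := Real.log_two_gt_d9
    have h3 : Real.log y * (10 + 1414 * x) ≤ Real.log y * (1424 * x) := by gcongr; linarith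
    have h4 : 0 ≤ x * Real.log y := by positivity
    nlinarith
  push_cast
  calc 3000 * (((trials k M : ℝ) * k + 1) * (((n : ℝ) + 1) * (k + 1) * (d + 1) * (M + 1)))
      ≤ 3000 * ((y ^ (1414 * x) * x + y ^ (1414 * x) * x) *
        ((n + n) * (x + x) * (d + d) * (101 * x + x))) := by
        gcongr
        exact one_le_mul_of_one_le_of_one_le hR1 hx1
    _ = 3000 * (n * d) * ((1632 * x ^ 3) * y ^ (1414 * x)) := by ring
    _ ≤ 3000 * (n * d) * (y ^ (10 : ℝ) * y ^ (1414 * x)) := by gcongr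
    _ ≤ _ := by gcongr

end RealRAM

/-- One randomized real-RAM program, with universal constants `A`, `a` and `δ > 0`, that halts on
every weighted instance and every random tape within `A * n * d * 2 ^ (A * x * (log (2 + x)) ^ a)`
steps, where `x = k ^ 2 / ε`, and whose output is a `(1 + ε)`-approximation with probability at
least `δ`. -/
theorem mainTheorem1 :
    ∃ (prog : RealRAM.Program) (A : ℝ) (a : ℕ) (δ : ℝ), 0 < δ ∧
      ∀ (n d k : ℕ) (ε : ℝ) (p : Fin n → EuclideanSpace ℝ (Fin d)) (w : Fin n → ℝ),
        1 ≤ n → 1 ≤ d → 1 ≤ k → 0 < ε → ε < 1 →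
        Function.Injective p → (∀ i, 1 ≤ w i) →
        (∀ ω : RealRAM.Tape, ∃ (s : RealRAM.State) (t : ℕ),
          RealRAM.Exec ω prog (RealRAM.inputState k ε p w) s t ∧
          (t : ℝ) ≤ A * ((n : ℝ) * (d : ℝ)) *
            (2 : ℝ) ^ (A * ((k : ℝ) ^ 2 / ε) * Real.log (2 + (k : ℝ) ^ 2 / ε) ^ a)) ∧
        ∃ E : Set RealRAM.Tape, MeasurableSet E ∧
          ENNReal.ofReal δ ≤ RealRAM.tapeLaw E ∧
          ∀ ω ∈ E, ∃ (s : RealRAM.State) (t : ℕ),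
            RealRAM.Exec ω prog (RealRAM.inputState k ε p w) s t ∧
            kMeansCost p w (RealRAM.outputCenters d k s) ≤ (1 + ε) * optKMeansCost k p w := by
  refine ⟨RealRAM.mainProg, 3000, 1, 1 / 2, by norm_num, ?_⟩
  intro n d k ε p w hn hd hk hε hε1 _ hw
  have hw0 : ∀ i, 0 < w i := fun i => zero_lt_one.trans_le (hw i)
  refine ⟨fun ω => ?_, ?_⟩
  · obtain ⟨s, t, hexec, ht, -⟩ := RealRAM.mainProg_runs (ω := ω) (p := p) (w := w) hn hk hε
    exact ⟨s, t, hexec, (Nat.cast_le.2 ht).trans (RealRAM.time_bound hn hd hk hε hε1)⟩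
  · obtain ⟨f, hf⟩ := RealRAM.exists_optimal_assignment (p := p) hk hw0
    have hM : 100 ≤ (⌈100 / ε⌉₊ : ℝ) * ε := (div_le_iff₀ hε).1 (Nat.le_ceil _)
    refine ⟨RealRAM.succSet p w ⌈100 / ε⌉₊
      ((1 + ε) * ∑ j, RealRAM.clusterCost p w (RealRAM.cluster f j))
      (RealRAM.trials k ⌈100 / ε⌉₊ * k) 0 (RealRAM.Conf.zero d k),
      RealRAM.measurableSet_succSet _ _ _, ?_, fun ω hω => ?_⟩
    · rw [← ofReal_measureReal]
      exact ENNReal.ofReal_le_ofReal (RealRAM.half_le_succSet hn hk hw0 hε hε1 hM f _)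
    · obtain ⟨s, t, hexec, -, hs⟩ := RealRAM.mainProg_runs (ω := ω) (p := p) (w := w) hn hk hε
      refine ⟨s, t, hexec, ?_⟩
      rw [hs]
      -- Only the fact that the assignment cost is a lower bound for every choice of centers is
      -- used; the infimum need not be attained.
      exact hω.trans (mul_le_mul_of_nonneg_left (le_ciInf hf) (by linarith))
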